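/- Let $m\ge n$, $\varepsilon,\tau>0$, $m_\mu,m_\nu>0$, and let $\mu=m_\mu\mathcal N(0,\Sigma_\mu)$ on $\mathbb R^m$ and $\nu=m_\nu\mathcal N(0,\Sigma_\nu)$ on $\mathbb R^n$ with $\Sigma_\mu=\mathrm{diag}(\lambda_{\mu,1},\dots,\lambda_{\mu,m})$, $\Sigma_\nu=\mathrm{diag}(\lambda_{\nu,1},\dots,\lambda_{\nu,n})$, where $\lambda_{\mu,1}\ge\dots\ge\lambda_{\mu,m}>0$ and $\lambda_{\nu,1}\ge\dots\ge\lambda_{\nu,n}>0$. For finite positive measures put $\mathrm{KL}(\alpha\|\beta)=\int\log\frac{d\alpha}{d\beta}\,d\alpha+\int(d\beta-d\alpha)$ and $\mathrm{KL}^{\otimes}(\alpha\|\beta)=\mathrm{KL}(\alpha\otimes\alpha\|\beta\otimes\beta)$; for positive numbers, $\mathrm{KL}(s\|t)=s\log\frac st-s+t$. Let $$\mathsf{UIGW}_{\varepsilon,\tau}(\mu,\nu)=\min_{\pi}\ \iint\big[\langle x,x'\rangle-\langle y,y'\rangle\big]^2d\pi(x,y)\,d\pi(x',y')+\tau\,\mathrm{KL}^{\otimes}(\pi_x\|\mu)+\tau\,\mathrm{KL}^{\otimes}(\pi_y\|\nu)+\varepsilon\,\mathrm{KL}^{\otimes}(\pi\|\mu\otimes\nu),$$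 where $\pi$ ranges over all finite positive measures on $\mathbb R^m\times\mathbb R^n$, with marginals $\pi_x,\pi_y$. Define, for $x,y,a,b>0$ and with $[t]^+=\max\{t,0\}$, $$g_{\varepsilon,\tau,+}(x,y;a,b)=x^2+y^2+(\tau+\varepsilon)\Big\{\frac xa+\frac yb-\log\frac{xy}{ab}-2\Big\}-2\Big[xy-\frac\varepsilon2\Big]^++\varepsilon\Big[\log(xy)-\log\frac\varepsilon2\Big]^+,$$ $$h_{\varepsilon,\tau}(x;a)=x^2+(\tau+\varepsilon)\Big\{\frac xa-\log\frac xa-1\Big\}.$$ (i) For $k\le n$ the function $g_{\varepsilon,\tau,+}(\cdot,\cdot;\lambda_{\mu,k},\lambda_{\nu,k})$ has a unique minimizer $(\varphi_k,\phi_k)$ over $x,y>0$, and for $n<k\le m$ the function $h_{\varepsilon,\tau}(\cdot;\lambda_{\mu,k})$ has a unique minimizer $\varphi_k$ over $x>0$. (ii) With $q(a)=-\frac{\tau+\varepsilon}{4a}+\frac12\sqrt{2(\tau+\varepsilon)+\frac{(\tau+\varepsilon)^2}{4a^2}}$ (the positive root of $2x^2+\frac{\tau+\varepsilon}{a}x-(\tau+\varepsilon)=0$),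 we have $\varphi_k=q(\lambda_{\mu,k})$ for $k>n$. For $k\le n$ write $a=\lambda_{\mu,k}$, $b=\lambda_{\nu,k}$. If $q(a)q(b)<\frac\varepsilon2$, then $(\varphi_k,\phi_k)=(q(a),q(b))$. If $q(a)q(b)\ge\frac\varepsilon2$, then the cubic equation $$\tau z^3+\Big(8\tau-\frac{(\tau+\varepsilon)^2}{ab}\Big)z^2+\Big(16\tau-2(\tau+\varepsilon)^2\Big(\frac1a+\frac1b\Big)^2\Big)z-4(\tau+\varepsilon)^2\Big(\frac1a+\frac1b\Big)^2=0$$ has a unique positive root $\hat z$, and $(\varphi_k,\phi_k)=(r(a),r(b))$ with $r(c)=-\frac{\tau+\varepsilon}{4c}+\frac12\sqrt{\frac{(\tau+\varepsilon)^2}{4c^2}+4\tau\big(\frac12+\frac1{\hat z}\big)}$. (iii) Put $\Upsilon^*=\sum_{k=1}^n g_{\varepsilon,\tau,+}(\varphi_k,\phi_k;\lambda_{\mu,k},\lambda_{\nu,k})+\sum_{k=n+1}^m h_{\varepsilon,\tau}(\varphi_k;\lambda_{\mu,k})$ and let $m_{\pi^*}>0$ be given by $$m_{\pi^*}^2=m_\mu^{\frac{2\tau}{2\tau+\varepsilon}}m_\nu^{\frac{2\tau}{2\tau+\varepsilon}}(m_\mu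 m_\nu)^{\frac{2\varepsilon}{2\tau+\varepsilon}}\exp\Big\{-\frac{\Upsilon^*}{2\tau+\varepsilon}\Big\}.$$ Then $$\mathsf{UIGW}_{\varepsilon,\tau}(\mu,\nu)=m_{\pi^*}^2\Upsilon^*+\tau\big\{\mathrm{KL}(m_{\pi^*}^2\|m_\mu^2)+\mathrm{KL}(m_{\pi^*}^2\|m_\nu^2)\big\}+\varepsilon\,\mathrm{KL}(m_{\pi^*}^2\|m_\mu^2m_\nu^2).$$ (iv) The scaled Gaussian measure $\pi^*=m_{\pi^*}\mathcal N(0,\Sigma_{\pi^*})$ is an optimal plan (a minimizer in the definition of $\mathsf{UIGW}_{\varepsilon,\tau}(\mu,\nu)$), where $$\Sigma_{\pi^*}=\begin{pmatrix}\Sigma_x^*&K_{xy}^*\\(K_{xy}^*)^\top&\Sigma_y^*\end{pmatrix},\quad \Sigma_x^*=\mathrm{diag}(\varphi_k)_{k=1}^m,\quad \Sigma_y^*=\mathrm{diag}(\phi_k)_{k=1}^n,$$ $\Sigma_{\pi^*}$ is positive definite, and $K_{xy}^*$ is the $m\times n$ matrix with diagonal entries $\psi_k^*=\big\{\big[1-\frac{\varepsilon}{2\varphi_k\phi_k}\big]^+\varphi_k\phi_k\big\}^{1/2}$,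 $k=1,\dots,n$, and all other entries $0$. -/

import Mathlib

open MeasureTheory ProbabilityTheory InformationTheory
open scoped ENNReal

noncomputable section

namespace EntropicUIGW

/-- The Euclidean space `ℝ^d`. -/
abbrev E (d : ℕ) : Type := EuclideanSpace ℝ (Fin d)

/-- The quadratic Kullback-Leibler divergence
`KL^⊗(α ‖ β) = KL(α ⊗ α ‖ β ⊗ β)`, where `KL` is the generalized divergence of finite measures
`KL(α ‖ β) = ∫ log (dα/dβ) dα + β(univ) - α(univ)` (`∞` when it does not make sense). -/
def klQuad {X : Type*} [MeasurableSpace X] (α β : Measure X) : ℝ≥0∞ :=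
  klDiv (α.prod α) (β.prod β)

/-- The inner product distortion
`∫∫ (⟨x, x'⟩ - ⟨y, y'⟩)² dπ(x, y) dπ(x', y')`. -/
def distortion {m n : ℕ} (π : Measure (E m × E n)) : ℝ≥0∞ :=
  ∫⁻ z, ENNReal.ofReal ((inner ℝ z.1.1 z.2.1 - inner ℝ z.1.2 z.2.2) ^ 2) ∂(π.prod π)

/-- The objective function of the entropic unbalanced inner product Gromov-Wasserstein problem;
`π.fst` and `π.snd` are the marginals of `π`. -/
def objective {m n : ℕ} (ε τ : ℝ) (μ : Measure (E m)) (ν : Measure (E n))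
    (π : Measure (E m × E n)) : ℝ≥0∞ :=
  distortion π + ENNReal.ofReal τ * klQuad π.fst μ + ENNReal.ofReal τ * klQuad π.snd ν
    + ENNReal.ofReal ε * klQuad π (μ.prod ν)

/-- The entropic unbalanced inner product Gromov-Wasserstein value: the infimum of the objective
over all finite positive measures on `ℝ^m × ℝ^n`. -/
def UIGW {m n : ℕ} (ε τ : ℝ) (μ : Measure (E m)) (ν : Measure (E n)) : ℝ≥0∞ :=
  ⨅ (π : Measure (E m × E n)) (_ : IsFiniteMeasure π), objective ε τ μ ν π

/-- `π` is an optimal transportation plan: a finite positive measure minimizing the objective. -/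
def IsOptimalPlan {m n : ℕ} (ε τ : ℝ) (μ : Measure (E m)) (ν : Measure (E n))
    (π : Measure (E m × E n)) : Prop :=
  IsFiniteMeasure π ∧
    ∀ π' : Measure (E m × E n), IsFiniteMeasure π' → objective ε τ μ ν π ≤ objective ε τ μ ν π'

/-- The unbalanced centred Gaussian measure `M · N(0, diag(l))` on `ℝ^d`. -/
def scaledGaussian {d : ℕ} (M : ℝ) (l : Fin d → ℝ) : Measure (E d) :=
  ENNReal.ofReal M • multivariateGaussian 0 (Matrix.diagonal l)

/-- The unbalanced centred Gaussian measure `M · N(0, S)` on `ℝ^m × ℝ^n`, for a covariance matrix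
`S` in block form. -/
def scaledGaussianProd {m n : ℕ} (M : ℝ) (S : Matrix (Fin m ⊕ Fin n) (Fin m ⊕ Fin n) ℝ) :
    Measure (E m × E n) :=
  ENNReal.ofReal M • (multivariateGaussian 0 S).map
    (fun z : EuclideanSpace ℝ (Fin m ⊕ Fin n) =>
      ((WithLp.toLp 2 (fun i => z (Sum.inl i)) : E m),
        (WithLp.toLp 2 (fun j => z (Sum.inr j)) : E n)))

/-- The rectangular `m × n` matrix with diagonal entries `ψ k`, `k < n`, and zeros elsewhere. -/
def rectDiag {m n : ℕ} (ψ : Fin n → ℝ) : Matrix (Fin m) (Fin n) ℝ :=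
  fun i j => if (i : ℕ) = (j : ℕ) then ψ j else 0

/-- The block matrix with diagonal blocks `diag(x)`, `diag(y)` and cross block `diag(ψ)`. -/
def blockCov {m n : ℕ} (x : Fin m → ℝ) (y ψ : Fin n → ℝ) :
    Matrix (Fin m ⊕ Fin n) (Fin m ⊕ Fin n) ℝ :=
  Matrix.fromBlocks (Matrix.diagonal x) (rectDiag ψ) (rectDiag ψ).transpose (Matrix.diagonal y)

/-- The generalized KL divergence of two positive numbers. -/
def klScalar (a b : ℝ) : ℝ := a * Real.log (a / b) - a + b

/-- The function `g_{ε,τ,+}(x, y; a, b)`. -/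
def gPlus (ε τ x y a b : ℝ) : ℝ :=
  x ^ 2 + y ^ 2 + (τ + ε) * (x / a + y / b - Real.log (x * y / (a * b)) - 2)
    - 2 * max (x * y - ε / 2) 0 + ε * max (Real.log (x * y) - Real.log (ε / 2)) 0

/-- The function `h_{ε,τ}(x; a)`. -/
def hFun (ε τ x a : ℝ) : ℝ :=
  x ^ 2 + (τ + ε) * (x / a - Real.log (x / a) - 1)

/-- The set of all minimizers of `g_{ε,τ,+}(·, ·; a, b)` over `x, y > 0`. -/
def argminG (ε τ a b : ℝ) : Set (ℝ × ℝ) :=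
  {p | 0 < p.1 ∧ 0 < p.2 ∧ ∀ x y : ℝ, 0 < x → 0 < y → gPlus ε τ p.1 p.2 a b ≤ gPlus ε τ x y a b}

/-- The set of all minimizers of `h_{ε,τ}(·; a)` over `x > 0`. -/
def argminH (ε τ a : ℝ) : Set ℝ :=
  {p | 0 < p ∧ ∀ x : ℝ, 0 < x → hFun ε τ p a ≤ hFun ε τ x a}

/-- The positive root `x` of the quadratic equation `2 x² + (τ + ε) x / a - (τ + ε) = 0`. -/
def quadSol (ε τ a : ℝ) : ℝ :=
  -((τ + ε) / (4 * a)) + 1 / 2 * Real.sqrt (2 * (τ + ε) + (τ + ε) ^ 2 / (4 * a ^ 2))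

/-- The cubic polynomial in `z` attached to the case of a nonzero cross-covariance. -/
def cubic (ε τ a b z : ℝ) : ℝ :=
  τ * z ^ 3 + (8 * τ - (τ + ε) ^ 2 / (a * b)) * z ^ 2
    + (16 * τ - 2 * (τ + ε) ^ 2 * (1 / a + 1 / b) ^ 2) * z
    - 4 * (τ + ε) ^ 2 * (1 / a + 1 / b) ^ 2

/-- The coordinate of the minimizer attached to a root `z` of the cubic. -/
def cubicSol (ε τ a z : ℝ) : ℝ :=
  -((τ + ε) / (4 * a))
    + 1 / 2 * Real.sqrt ((τ + ε) ^ 2 / (4 * a ^ 2) + 4 * τ * (1 / 2 + 1 / z))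

/-- `Υ = ∑_{k ≤ n} g_{ε,τ,+}(x_k, y_k; λ_{μ,k}, λ_{ν,k}) + ∑_{n < k ≤ m} h_{ε,τ}(x_k; λ_{μ,k})`. -/
def upsilon {m n : ℕ} (hnm : n ≤ m) (ε τ : ℝ) (lμ : Fin m → ℝ) (lν : Fin n → ℝ)
    (x : Fin m → ℝ) (y : Fin n → ℝ) : ℝ :=
  ∑ k : Fin n, gPlus ε τ (x (Fin.castLE hnm k)) (y k) (lμ (Fin.castLE hnm k)) (lν k)
    + ∑ k ∈ Finset.univ.filter (fun k : Fin m => n ≤ (k : ℕ)), hFun ε τ (x k) (lμ k)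

/-- The optimal squared mass as a function of `Υ`. -/
def massSq (ε τ mμ mν Υ : ℝ) : ℝ :=
  mμ ^ (2 * τ / (2 * τ + ε)) * mν ^ (2 * τ / (2 * τ + ε))
    * (mμ * mν) ^ (2 * ε / (2 * τ + ε)) * Real.exp (-(Υ / (2 * τ + ε)))

end EntropicUIGW

end

/-!
The problem is reduced in three steps to scalar ones.

*Reduction to Gaussian measures.* Write a plan as a measure `ρ` on `ℝ^(m+n)` of mass `p`. The
distortion `∬ (⟨x, x'⟩ - ⟨y, y'⟩)²` depends on `ρ` only through its matrix of second moments
(`distortion_splitMeasure`). Each of the three divergences is bounded from below by testing the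
Donsker-Varadhan inequality (`integral_sub_le_klDiv`, `le_klQuad`) with the log-density of the
Gaussian measure that has the same normalized second moments. This gives the divergence of that
Gaussian measure, plus a divergence between squared masses (`gaussKL_le_klQuad`). The second moments
may be degenerate, so a multiple `δ I` of the identity is added to them, and `δ → 0` at the end
(`massCost_le_objective`). They are finite, because a measure with finite divergence from a Gaussian
integrates `‖z‖²` (`integrable_of_klQuad_ne_top`). For a Gaussian plan all bounds are equalities
(`objective_gaussian`). What remains is to minimize `covCost` over covariance matrices
`[X, K; Kᵀ, Y]`, and then a convex function of the squared mass (`massSq_minimizes`).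

*Reduction to diagonal matrices.* Only the terms `∑ Xᵢᵢ / λ_{μ,i}` and `∑ Yⱼⱼ / λ_{ν,j}` of `covCost`
see the basis, and by Schur's majorization theorem (`sum_mul_diag_le`) they decrease when `X` and `Y`
are replaced by their spectra in decreasing order. With `K = X^{1/2} C Y^{1/2}`, the dependence on `K`
is through `-2 ‖K‖² - ε log det (1 - C Cᵀ)`; the singular values of `C` determine the second term,
and a trace inequality of von Neumann type (`sum_weighted_sq_le`) bounds the first. Minimization over
the singular values gives the coupling part of `g_{ε,τ,+}` (`crossTerm_le`), whence
`exists_upsilon_le_covCost`. Equality holds for the block matrix of the theorem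
(`covCost_blockCov`).

*Scalar problems.* The function `h_{ε,τ}`, and `g_{ε,τ,+}` without its coupling part, are strictly
convex, with minimizers given by `quadSol`. On `{xy ≥ ε/2}`, the function `g_{ε,τ,+}` coincides with
a strictly convex function, the coupled one, which bounds it from below everywhere. If
`q(a) q(b) < ε/2`, the point `(q(a), q(b))` stays optimal (`gPlus_ge_of_decoupled`). Otherwise the
critical point of the coupled function lies in `{xy ≥ ε/2}` (`coupled_critical_mem`), hence it
minimizes `g_{ε,τ,+}` (`gPlus_ge_of_coupled`). At this point `z = τ / (xy)` is a root of the cubic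
(`cubic_of_critical`), which has only one positive root by Descartes' rule of signs
(`cubic_root_unique`).
-/

noncomputable section

namespace EntropicUIGW

/-! ### The two-variable and one-variable scalar problems -/

/-- The coupling part of `g_{ε,τ,+}` as a function of `t = xy`. It equals
`min_{0 ≤ s < 1} (-2 t s - ε log (1 - s))`, see `crossTerm_le`. -/
def crossTerm (ε t : ℝ) : ℝ :=
  -2 * max (t - ε / 2) 0 + ε * max (Real.log t - Real.log (ε / 2)) 0

lemma crossTerm_of_le {ε t : ℝ} (ht : 0 < t) (h : t ≤ ε / 2) : crossTerm ε t = 0 := by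
  have h1 := Real.log_le_log ht h
  rw [crossTerm, max_eq_right (by linarith), max_eq_right (by linarith)]
  ring

lemma crossTerm_of_ge {ε t : ℝ} (hε : 0 < ε) (h : ε / 2 ≤ t) :
    crossTerm ε t = -2 * t + ε + ε * (Real.log t - Real.log (ε / 2)) := by
  have h1 := Real.log_le_log (by linarith) h
  rw [crossTerm, max_eq_left (by linarith), max_eq_left (by linarith)]
  ring

lemma mul_log_sub_log_le {ε t : ℝ} (hε : 0 < ε) (ht : 0 < t) :
    ε * (Real.log t - Real.log (ε / 2)) ≤ 2 * t - ε := by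
  have h := Real.log_le_sub_one_of_pos (x := t / (ε / 2)) (by positivity)
  rw [Real.log_div (by positivity) (by positivity)] at h
  have h2 : ε * (t / (ε / 2) - 1) = 2 * t - ε := by field_simp
  have := mul_le_mul_of_nonneg_left h hε.le
  linarith

/-- The formula for the coupling part on `{t ≥ ε/2}` is a lower bound everywhere. -/
lemma le_crossTerm {ε t : ℝ} (hε : 0 < ε) (ht : 0 < t) :
    -2 * t + ε + ε * (Real.log t - Real.log (ε / 2)) ≤ crossTerm ε t := by
  rcases le_total t (ε / 2) with h | h
  · rw [crossTerm_of_le ht h]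
    linarith [mul_log_sub_log_le hε ht]
  · rw [crossTerm_of_ge hε h]

lemma crossTerm_le {ε t s : ℝ} (hε : 0 < ε) (ht : 0 < t) (hs0 : 0 ≤ s) (hs1 : s < 1) :
    crossTerm ε t ≤ -2 * t * s - ε * Real.log (1 - s) := by
  rcases le_total t (ε / 2) with h | h
  · rw [crossTerm_of_le ht h]
    have := Real.log_le_sub_one_of_pos (x := 1 - s) (by linarith)
    nlinarith
  · rw [crossTerm_of_ge hε h]
    have h1 := mul_log_sub_log_le hε (t := t * (1 - s)) (mul_pos ht (by linarith))
    rw [Real.log_mul ht.ne' (by linarith)] at h1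
    linarith

lemma crossTerm_eq {ε t : ℝ} (hε : 0 < ε) (ht : 0 < t) :
    crossTerm ε t = -2 * max (t - ε / 2) 0 - ε * Real.log (t - max (t - ε / 2) 0)
      + ε * Real.log t := by
  rcases le_total t (ε / 2) with h | h
  · rw [crossTerm_of_le ht h, max_eq_right (by linarith)]
    simp
  · rw [crossTerm_of_ge hε h, max_eq_left (by linarith)]
    rw [show t - (t - ε / 2) = ε / 2 by ring]
    ring

lemma gPlus_eq {ε τ x y a b : ℝ} (hx : 0 < x) (hy : 0 < y) (ha : 0 < a) (hb : 0 < b) :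
    gPlus ε τ x y a b = x ^ 2 + y ^ 2 + (τ + ε) * (x / a + y / b - Real.log x - Real.log y
      + Real.log a + Real.log b - 2) + crossTerm ε (x * y) := by
  rw [gPlus, crossTerm, Real.log_div (by positivity) (by positivity),
    Real.log_mul hx.ne' hy.ne', Real.log_mul ha.ne' hb.ne']
  ring

/-- `L(r) = r - 1 - log r` at `r = x / q`, which is positive unless `x = q`. -/
def logGap (x q : ℝ) : ℝ := x / q - 1 - (Real.log x - Real.log q)

lemma logGap_nonneg {x q : ℝ} (hx : 0 < x) (hq : 0 < q) : 0 ≤ logGap x q := by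
  have := Real.log_le_sub_one_of_pos (x := x / q) (by positivity)
  rw [Real.log_div hx.ne' hq.ne'] at this
  rw [logGap]; linarith

lemma eq_of_logGap_nonpos {x q : ℝ} (hx : 0 < x) (hq : 0 < q) (h : logGap x q ≤ 0) : x = q := by
  by_contra hne
  have := Real.log_lt_sub_one_of_pos (x := x / q) (by positivity)
    (by rwa [Ne, div_eq_one_iff_eq hq.ne'])
  rw [Real.log_div hx.ne' hq.ne'] at this
  rw [logGap] at h; linarith

/-- The positive root of `2 X² + k X = 2 w`. -/
lemma quadratic_root {k w : ℝ} (hk : 0 < k) (hw : 0 < w) :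
    0 < -(k / 4) + 1 / 2 * Real.sqrt (k ^ 2 / 4 + 4 * w) ∧
    2 * (-(k / 4) + 1 / 2 * Real.sqrt (k ^ 2 / 4 + 4 * w)) ^ 2
      + k * (-(k / 4) + 1 / 2 * Real.sqrt (k ^ 2 / 4 + 4 * w)) = 2 * w := by
  have h1 : k / 2 < Real.sqrt (k ^ 2 / 4 + 4 * w) := by
    apply Real.lt_sqrt_of_sq_lt; nlinarith
  have h2 := Real.sq_sqrt (show 0 ≤ k ^ 2 / 4 + 4 * w by positivity)
  exact ⟨by linarith, by nlinarith⟩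

lemma quadratic_root_unique {k w X Y : ℝ} (hk : 0 < k) (hX : 0 < X) (hY : 0 < Y)
    (h1 : 2 * X ^ 2 + k * X = 2 * w) (h2 : 2 * Y ^ 2 + k * Y = 2 * w) : X = Y := by
  have h : (X - Y) * (2 * (X + Y) + k) = 0 := by linear_combination h1 - h2
  rcases mul_eq_zero.1 h with h | h
  · linarith
  · nlinarith

section quadSol

variable {ε τ a : ℝ}

lemma quadSol_eq_root :
    quadSol ε τ a = -((τ + ε) / a / 4)
      + 1 / 2 * Real.sqrt (((τ + ε) / a) ^ 2 / 4 + 4 * ((τ + ε) / 2)) := by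
  have h1 : (τ + ε) / (4 * a) = (τ + ε) / a / 4 := by rw [div_div, mul_comm]
  have h2 : 2 * (τ + ε) + (τ + ε) ^ 2 / (4 * a ^ 2)
      = ((τ + ε) / a) ^ 2 / 4 + 4 * ((τ + ε) / 2) := by
    rw [div_pow, div_div, mul_comm 4 (a ^ 2)]; ring
  rw [quadSol, h1, h2]

lemma quadSol_pos (hε : 0 < ε) (hτ : 0 < τ) (ha : 0 < a) : 0 < quadSol ε τ a := by
  rw [quadSol_eq_root]
  exact (quadratic_root (by positivity) (by positivity)).1

lemma quadSol_quadratic (hε : 0 < ε) (hτ : 0 < τ) (ha : 0 < a) :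
    2 * quadSol ε τ a ^ 2 + (τ + ε) / a * quadSol ε τ a = τ + ε := by
  rw [quadSol_eq_root]
  have := (quadratic_root (k := (τ + ε) / a) (w := (τ + ε) / 2)
    (by positivity) (by positivity)).2
  linarith

lemma quadSol_critical (hε : 0 < ε) (hτ : 0 < τ) (ha : 0 < a) :
    (τ + ε) / a = (τ + ε) / quadSol ε τ a - 2 * quadSol ε τ a := by
  have h := quadSol_quadratic hε hτ ha
  have hq := quadSol_pos hε hτ ha
  have h3 : (τ + ε) / quadSol ε τ a - 2 * quadSol ε τ a
      = ((τ + ε) - 2 * quadSol ε τ a ^ 2) / quadSol ε τ a := by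
    field_simp
  rw [h3, eq_div_iff hq.ne']
  linarith

end quadSol

lemma hFun_sub {ε τ a q x : ℝ} (ha : 0 < a) (hq : 0 < q) (hx : 0 < x)
    (hcrit : (τ + ε) / a = (τ + ε) / q - 2 * q) :
    hFun ε τ x a = hFun ε τ q a + (x - q) ^ 2 + (τ + ε) * logGap x q := by
  rw [hFun, hFun, logGap, Real.log_div hx.ne' ha.ne', Real.log_div hq.ne' ha.ne']
  have h1 : (τ + ε) * (x / a) = ((τ + ε) / q - 2 * q) * x := by rw [← hcrit]; ring
  have h2 : (τ + ε) * (q / a) = ((τ + ε) / q - 2 * q) * q := by rw [← hcrit]; ring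
  have h3 : (τ + ε) / q * q = τ + ε := by field_simp
  linear_combination h1 - h2 - h3

lemma argminH_eq {ε τ a : ℝ} (hε : 0 < ε) (hτ : 0 < τ) (ha : 0 < a) :
    argminH ε τ a = {quadSol ε τ a} := by
  have hq := quadSol_pos hε hτ ha
  have key : ∀ x, 0 < x → hFun ε τ x a
      = hFun ε τ (quadSol ε τ a) a + (x - quadSol ε τ a) ^ 2
        + (τ + ε) * logGap x (quadSol ε τ a) :=
    fun x hx => hFun_sub ha hq hx (quadSol_critical hε hτ ha)
  ext p
  constructor
  · rintro ⟨hp, hmin⟩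
    have h1 := hmin _ hq
    rw [key p hp] at h1
    have h2 := mul_nonneg (add_pos hτ hε).le (logGap_nonneg hp hq)
    have : (p - quadSol ε τ a) ^ 2 = 0 := le_antisymm (by linarith) (sq_nonneg _)
    exact sub_eq_zero.1 (pow_eq_zero_iff (two_ne_zero) |>.1 this)
  · rintro rfl
    refine ⟨hq, fun x hx => ?_⟩
    rw [key x hx]
    have h2 := mul_nonneg (add_pos hτ hε).le (logGap_nonneg hx hq)
    linarith [sq_nonneg (x - quadSol ε τ a)]

/-- Increment of `g_{ε,τ,+}` without its coupling part from the critical point `(q, p)` of the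
decoupled problem. -/
lemma decoupled_sub {ε τ a b q p x y : ℝ} (hq : 0 < q) (hp : 0 < p)
    (ha : (τ + ε) / a = (τ + ε) / q - 2 * q) (hb : (τ + ε) / b = (τ + ε) / p - 2 * p) :
    x ^ 2 + y ^ 2 + (τ + ε) * (x / a + y / b - Real.log x - Real.log y
        + Real.log a + Real.log b - 2)
      = q ^ 2 + p ^ 2 + (τ + ε) * (q / a + p / b - Real.log q - Real.log p
        + Real.log a + Real.log b - 2)
        + (x - q) ^ 2 + (y - p) ^ 2 + (τ + ε) * (logGap x q + logGap y p) := by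
  have h1 : (τ + ε) * (x / a) = ((τ + ε) / q - 2 * q) * x := by rw [← ha]; ring
  have h2 : (τ + ε) * (q / a) = ((τ + ε) / q - 2 * q) * q := by rw [← ha]; ring
  have h3 : (τ + ε) / q * q = τ + ε := by field_simp
  have h1' : (τ + ε) * (y / b) = ((τ + ε) / p - 2 * p) * y := by rw [← hb]; ring
  have h2' : (τ + ε) * (p / b) = ((τ + ε) / p - 2 * p) * p := by rw [← hb]; ring
  have h3' : (τ + ε) / p * p = τ + ε := by field_simp
  rw [logGap, logGap]
  linear_combination h1 - h2 - h3 + h1' - h2' - h3'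

/-- The gain of the coupling part on `{xy ≥ ε/2}` does not exceed the cost of leaving a point
`(q, p)` with `qp ≤ ε/2`. The difference is concave in `ε/2` and nonnegative at the two ends
`ε/2 = qp` and `ε/2 = xy`. -/
lemma coupling_gain_le {ε q p x y : ℝ} (hq : 0 < q) (hp : 0 < p)
    (hx : 0 < x) (hy : 0 < y) (h1 : q * p < ε / 2) (h2 : ε / 2 ≤ x * y) :
    0 ≤ (x - q) ^ 2 + (y - p) ^ 2 + ε * (logGap x q + logGap y p)
      + (-2 * (x * y) + ε + ε * (Real.log (x * y) - Real.log (ε / 2))) := by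
  set e := ε / 2 with he
  have hεe : ε = 2 * e := by rw [he]; ring
  set s := q * p with hs
  set t := x * y with ht
  have hst : s < t := h1.trans_le h2
  have hs0 : 0 < s := mul_pos hq hp
  have ht0 : 0 < t := mul_pos hx hy
  set θ := (e - s) / (t - s) with hθ
  have hts : 0 < t - s := by linarith
  have hθ0 : 0 ≤ θ := div_nonneg (by linarith) hts.le
  have hθ1 : θ ≤ 1 := (div_le_one hts).2 (by linarith)
  have hcomb : (1 - θ) * s + θ * t = e := by
    rw [hθ]; field_simp; ring
  have hconv := Real.convexOn_mul_log.2 (Set.mem_Ici.2 hs0.le) (Set.mem_Ici.2 ht0.le)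
    (show 0 ≤ 1 - θ by linarith) hθ0 (by ring)
  simp only [smul_eq_mul, hcomb] at hconv
  have hls : Real.log s = Real.log q + Real.log p := Real.log_mul hq.ne' hp.ne'
  have hlt : Real.log t = Real.log x + Real.log y := Real.log_mul hx.ne' hy.ne'
  have hend0 : 0 ≤ (x - q) ^ 2 + (y - p) ^ 2 - 2 * t + 2 * s * (x / q + y / p - 1) := by
    have : (x - q) ^ 2 + (y - p) ^ 2 - 2 * t + 2 * s * (x / q + y / p - 1)
        = (x - y - q + p) ^ 2 := by
      rw [hs, ht]; field_simp; ring
    rw [this]; positivity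
  have hend1 : 0 ≤ (x - q) ^ 2 + (y - p) ^ 2 - 2 * t + 2 * t * (x / q + y / p - 1)
      - 2 * t * (Real.log t - Real.log s) := by
    have h3 := mul_nonneg (mul_nonneg zero_le_two ht0.le)
      (add_nonneg (logGap_nonneg hx hq) (logGap_nonneg hy hp))
    rw [logGap, logGap] at h3
    rw [hlt, hls]
    nlinarith [sq_nonneg (x - q), sq_nonneg (y - p)]
  have e0 := mul_nonneg (sub_nonneg.2 hθ1) hend0
  have e1 := mul_nonneg hθ0 hend1
  rw [logGap, logGap, hεe]
  have hgoal : (x - q) ^ 2 + (y - p) ^ 2 + 2 * e * (x / q - 1 - (Real.log x - Real.log q)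
      + (y / p - 1 - (Real.log y - Real.log p)))
      + (-2 * t + 2 * e + 2 * e * (Real.log t - Real.log e))
      = (x - q) ^ 2 + (y - p) ^ 2 - 2 * t + 2 * e * (x / q + y / p - 1 + Real.log s)
        - 2 * (e * Real.log e) := by
    rw [hlt, hls]; ring
  rw [hgoal]
  have hsplit : 2 * e * (x / q + y / p - 1 + Real.log s)
      = (1 - θ) * (2 * s * (x / q + y / p - 1 + Real.log s))
        + θ * (2 * t * (x / q + y / p - 1 + Real.log s)) := by
    rw [← hcomb]; ring
  rw [hsplit]
  nlinarith

/-- If the decoupled minimizer `(q, p)` has `qp < ε/2`, then it minimizes `g_{ε,τ,+}`. -/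
lemma gPlus_ge_of_decoupled {ε τ a b q p x y : ℝ} (hε : 0 < ε)
    (ha0 : 0 < a) (hb0 : 0 < b) (hq : 0 < q) (hp : 0 < p)
    (hx : 0 < x) (hy : 0 < y) (h1 : q * p < ε / 2)
    (ha : (τ + ε) / a = (τ + ε) / q - 2 * q) (hb : (τ + ε) / b = (τ + ε) / p - 2 * p) :
    gPlus ε τ q p a b + τ * (logGap x q + logGap y p) ≤ gPlus ε τ x y a b := by
  rw [gPlus_eq hx hy ha0 hb0, gPlus_eq hq hp ha0 hb0, decoupled_sub (x := x) (y := y) hq hp ha hb,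
    crossTerm_of_le (mul_pos hq hp) h1.le]
  have hL := mul_nonneg hε.le (add_nonneg (logGap_nonneg hx hq) (logGap_nonneg hy hp))
  rcases le_total (x * y) (ε / 2) with h | h
  · rw [crossTerm_of_le (mul_pos hx hy) h]
    nlinarith [sq_nonneg (x - q), sq_nonneg (y - p)]
  · have := coupling_gain_le hq hp hx hy h1 h
    rw [crossTerm_of_ge hε h]
    linarith

/-- A critical point `(X, Y)` of the coupled function with `XY ≥ ε/2` minimizes `g_{ε,τ,+}`: the
coupled function is convex and lies below `g_{ε,τ,+}`. -/
lemma gPlus_ge_of_coupled {ε τ a b X Y x y : ℝ} (hε : 0 < ε)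
    (ha0 : 0 < a) (hb0 : 0 < b) (hX : 0 < X) (hY : 0 < Y)
    (hx : 0 < x) (hy : 0 < y) (h1 : ε / 2 ≤ X * Y)
    (ha : (τ + ε) / a = τ / X - 2 * (X - Y)) (hb : (τ + ε) / b = τ / Y + 2 * (X - Y)) :
    gPlus ε τ X Y a b + τ * (logGap x X + logGap y Y) ≤ gPlus ε τ x y a b := by
  rw [gPlus_eq hx hy ha0 hb0, gPlus_eq hX hY ha0 hb0, crossTerm_of_ge hε h1]
  have h := le_crossTerm hε (mul_pos hx hy)
  rw [Real.log_mul hx.ne' hy.ne'] at h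
  rw [Real.log_mul hX.ne' hY.ne', logGap, logGap]
  have h1 : (τ + ε) * (x / a) = (τ / X - 2 * (X - Y)) * x := by rw [← ha]; ring
  have h2 : (τ + ε) * (X / a) = (τ / X - 2 * (X - Y)) * X := by rw [← ha]; ring
  have h3 : τ / X * X = τ := by field_simp
  have h1' : (τ + ε) * (y / b) = (τ / Y + 2 * (X - Y)) * y := by rw [← hb]; ring
  have h2' : (τ + ε) * (Y / b) = (τ / Y + 2 * (X - Y)) * Y := by rw [← hb]; ring
  have h3' : τ / Y * Y = τ := by field_simp
  have h4 : τ * (x / X) = τ / X * x := by ring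
  have h4' : τ * (y / Y) = τ / Y * y := by ring
  nlinarith [sq_nonneg ((x - y) - (X - Y))]

lemma argminG_eq_of_gap {ε τ a b X Y : ℝ} (hτ : 0 < τ) (hX : 0 < X) (hY : 0 < Y)
    (h : ∀ x y, 0 < x → 0 < y →
      gPlus ε τ X Y a b + τ * (logGap x X + logGap y Y) ≤ gPlus ε τ x y a b) :
    argminG ε τ a b = {(X, Y)} := by
  ext ⟨x, y⟩
  constructor
  · rintro ⟨hx, hy, hmin⟩
    have h1 := hmin X Y hX hY
    have h2 := h x y hx hy
    simp only at hx hy h1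
    have hLx := logGap_nonneg hx hX
    have hLy := logGap_nonneg hy hY
    have h3 : logGap x X + logGap y Y ≤ 0 := by
      by_contra hc
      have := mul_pos hτ (not_le.1 hc)
      linarith
    rw [eq_of_logGap_nonpos hx hX (by linarith), eq_of_logGap_nonpos hy hY (by linarith)]
    rfl
  · rintro hxy
    obtain ⟨rfl, rfl⟩ := Prod.mk.inj hxy
    refine ⟨hX, hY, fun x' y' hx hy => ?_⟩
    have h2 := h x' y' hx hy
    have := mul_nonneg hτ.le (add_nonneg (logGap_nonneg hx hX) (logGap_nonneg hy hY))
    simp only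
    linarith

/-- The coupled function `(x - y)² + k x + l y - τ log (xy)` has a critical point. With
`d = X - Y` the equations become a single cubic equation for `d`. -/
lemma exists_coupled_critical {k l τ : ℝ} (hk : 0 < k) (hl : 0 < l) (hτ : 0 < τ) :
    ∃ X Y : ℝ, 0 < X ∧ 0 < Y ∧ k = τ / X - 2 * (X - Y) ∧ l = τ / Y + 2 * (X - Y) := by
  let P : ℝ → ℝ := fun d => τ * (l - 2 * d) - τ * (k + 2 * d) - d * (k + 2 * d) * (l - 2 * d)
  have hcont : Continuous P := by fun_prop
  have h0 : P (l / 2) < 0 := by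
    have : P (l / 2) = -(τ * (k + l)) := by simp only [P]; ring
    rw [this]; have := mul_pos hτ (add_pos hk hl); linarith
  have h1 : 0 < P (-(k / 2)) := by
    have : P (-(k / 2)) = τ * (k + l) := by simp only [P]; ring
    rw [this]; exact mul_pos hτ (add_pos hk hl)
  obtain ⟨d, ⟨hd1, hd2⟩, hd⟩ := intermediate_value_Icc' (show -(k / 2) ≤ l / 2 by linarith)
    hcont.continuousOn ⟨h0.le, h1.le⟩
  have hd1' : 0 < k + 2 * d := by
    rcases hd1.lt_or_eq with h | h
    · linarith
    · rw [← h] at hd; linarith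
  have hd2' : 0 < l - 2 * d := by
    rcases hd2.lt_or_eq with h | h
    · linarith
    · rw [h] at hd; linarith
  have hdiff : τ / (k + 2 * d) - τ / (l - 2 * d) = d := by
    simp only [P] at hd
    field_simp
    linarith
  refine ⟨τ / (k + 2 * d), τ / (l - 2 * d), by positivity, by positivity, ?_, ?_⟩
  · rw [hdiff, div_div_cancel₀ hτ.ne']; ring
  · rw [hdiff, div_div_cancel₀ hτ.ne']; ring

/-- The critical point of the coupled function lies in the region `{XY ≥ ε/2}` as soon as the
critical point `(q, p)` of the decoupled one does. Otherwise there is a point `(u, v)` on the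
segment between the two with `uv = ε/2`, where both gradients agree; monotonicity of the two
gradients gives contradictory signs. -/
lemma coupled_critical_mem {k l ε τ q p X Y : ℝ} (hε : 0 < ε) (hτ : 0 < τ)
    (hk : 0 < k) (hl : 0 < l)
    (hq : 0 < q) (hp : 0 < p) (hX : 0 < X) (hY : 0 < Y)
    (hqk : k = (τ + ε) / q - 2 * q) (hpl : l = (τ + ε) / p - 2 * p)
    (hXk : k = τ / X - 2 * (X - Y)) (hYl : l = τ / Y + 2 * (X - Y))
    (h : ε / 2 ≤ q * p) : ε / 2 ≤ X * Y := by
  by_contra hlt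
  rw [not_le] at hlt
  have hXq : X < q := by
    by_contra hc
    rw [not_lt] at hc
    have e1 : k * q = τ + ε - 2 * q ^ 2 := by rw [hqk]; field_simp
    have e2 : k * X = τ - 2 * X ^ 2 + 2 * (X * Y) := by rw [hXk]; field_simp; ring
    have := mul_le_mul_of_nonneg_left hc hk.le
    nlinarith
  have hYp : Y < p := by
    by_contra hc
    rw [not_lt] at hc
    have e1 : l * p = τ + ε - 2 * p ^ 2 := by rw [hpl]; field_simp
    have e2 : l * Y = τ - 2 * Y ^ 2 + 2 * (X * Y) := by rw [hYl]; field_simp; ring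
    have := mul_le_mul_of_nonneg_left hc hl.le
    nlinarith
  obtain ⟨s, ⟨hs0, hs1⟩, hs⟩ := intermediate_value_Icc zero_le_one
    (f := fun s : ℝ => (X + s * (q - X)) * (Y + s * (p - Y)))
    (by fun_prop) (show ε / 2 ∈ Set.Icc _ _ by
      constructor
      · simpa using hlt.le
      · simpa using h)
  simp only at hs
  have hs0' : 0 < s := by
    rcases hs0.lt_or_eq with h | h
    · exact h
    · rw [← h] at hs; simp at hs; linarith
  set u := X + s * (q - X) with hu
  set v := Y + s * (p - Y) with hv
  have hXu : X < u := by rw [hu]; nlinarith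
  have hYv : Y < v := by rw [hv]; nlinarith
  have huq : u ≤ q := by rw [hu]; nlinarith
  have hvp : v ≤ p := by rw [hv]; nlinarith
  have hu0 : 0 < u := hX.trans hXu
  have hv0 : 0 < v := hY.trans hYv
  have hA : 2 * (u - v) + k - τ / u ≤ 0 := by
    have e1 : (τ + ε) / q ≤ (τ + ε) / u := by gcongr
    have e2 : ε / u = 2 * v := by
      rw [div_eq_iff hu0.ne']; linarith
    rw [hqk]
    have e3 : (τ + ε) / u = τ / u + ε / u := add_div _ _ _
    linarith
  have hB : -2 * (u - v) + l - τ / v ≤ 0 := by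
    have e1 : (τ + ε) / p ≤ (τ + ε) / v := by gcongr
    have e2 : ε / v = 2 * u := by
      rw [div_eq_iff hv0.ne']; linarith
    rw [hpl]
    have e3 : (τ + ε) / v = τ / v + ε / v := add_div _ _ _
    linarith
  have h1 : (2 * (u - v) + k - τ / u) * (u - X) ≤ 0 :=
    mul_nonpos_of_nonpos_of_nonneg hA (by linarith)
  have h2 : (-2 * (u - v) + l - τ / v) * (v - Y) ≤ 0 :=
    mul_nonpos_of_nonpos_of_nonneg hB (by linarith)
  have h3 : (2 * (u - v) + k - τ / u) * (u - X) + (-2 * (u - v) + l - τ / v) * (v - Y)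
      = 2 * ((u - v) - (X - Y)) ^ 2 + (τ / X - τ / u) * (u - X) + (τ / Y - τ / v) * (v - Y) := by
    rw [hXk, hYl]; ring
  have h4 : 0 < (τ / X - τ / u) * (u - X) :=
    mul_pos (sub_pos.2 (div_lt_div_of_pos_left hτ hX hXu)) (by linarith)
  have h5 : 0 < (τ / Y - τ / v) * (v - Y) :=
    mul_pos (sub_pos.2 (div_lt_div_of_pos_left hτ hY hYv)) (by linarith)
  nlinarith [sq_nonneg ((u - v) - (X - Y))]

/-- Descartes' rule of signs for a cubic with positive leading and negative constant coefficient
whose middle coefficients are not of signs `-`, `+`. -/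
lemma cubic_root_unique {A B C D z w : ℝ} (hA : 0 < A) (hD : D < 0) (hBC : 0 < C → 0 ≤ B)
    (hz : 0 < z) (hw : 0 < w) (h1 : A * z ^ 3 + B * z ^ 2 + C * z + D = 0)
    (h2 : A * w ^ 3 + B * w ^ 2 + C * w + D = 0) : z = w := by
  rcases le_or_gt C 0 with hC | hC
  · -- after division by `z²` the cubic is increasing in `z`
    have key : (z - w) * (A * z ^ 2 * w ^ 2 - C * z * w - D * (z + w)) = 0 := by
      linear_combination w ^ 2 * h1 - z ^ 2 * h2
    have hpos : 0 < A * z ^ 2 * w ^ 2 - C * z * w - D * (z + w) := by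
      have := mul_nonneg (mul_nonneg (neg_nonneg.2 hC) hz.le) hw.le
      have := mul_pos (neg_pos.2 hD) (add_pos hz hw)
      have : 0 < A * z ^ 2 * w ^ 2 := by positivity
      linarith
    exact sub_eq_zero.1 ((mul_eq_zero.1 key).resolve_right hpos.ne')
  · -- after division by `z` the cubic is increasing in `z`
    have hB := hBC hC
    have key : (z - w) * (A * z * w * (z + w) + B * z * w - D) = 0 := by
      linear_combination w * h1 - z * h2
    have hpos : 0 < A * z * w * (z + w) + B * z * w - D := by
      have : 0 ≤ B * z * w := by positivity
      have : 0 < A * z * w * (z + w) := by positivity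
      linarith
    exact sub_eq_zero.1 ((mul_eq_zero.1 key).resolve_right hpos.ne')

lemma cubic_positive_root_unique {ε τ a b z w : ℝ} (hε : 0 < ε) (hτ : 0 < τ) (ha : 0 < a)
    (hb : 0 < b) (hz : 0 < z) (hw : 0 < w) (h1 : cubic ε τ a b z = 0)
    (h2 : cubic ε τ a b w = 0) : z = w := by
  refine cubic_root_unique (A := τ) (B := 8 * τ - (τ + ε) ^ 2 / (a * b))
    (C := 16 * τ - 2 * (τ + ε) ^ 2 * (1 / a + 1 / b) ^ 2)
    (D := -(4 * (τ + ε) ^ 2 * (1 / a + 1 / b) ^ 2)) hτ ?_ ?_ hz hw ?_ ?_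
  · have : 0 < 4 * (τ + ε) ^ 2 * (1 / a + 1 / b) ^ 2 := by positivity
    linarith
  · intro hC
    have h3 : (τ + ε) ^ 2 / (a * b) = (τ + ε) ^ 2 * ((1 / a) * (1 / b)) := by
      field_simp
    have h4 : 4 * ((1 / a) * (1 / b)) ≤ (1 / a + 1 / b) ^ 2 := by
      nlinarith [sq_nonneg (1 / a - 1 / b)]
    have h5 := mul_le_mul_of_nonneg_left h4 (sq_nonneg (τ + ε))
    rw [h3]
    nlinarith
  · rw [cubic] at h1; linarith
  · rw [cubic] at h2; linarith

/-- At a critical point `(X, Y)` of the coupled function, `z = τ / (XY)` is a root of the cubic. -/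
lemma cubic_of_critical {ε τ a b X Y : ℝ} (hX : 0 < X) (hY : 0 < Y)
    (ha : (τ + ε) / a = τ / X - 2 * (X - Y)) (hb : (τ + ε) / b = τ / Y + 2 * (X - Y)) :
    cubic ε τ a b (τ / (X * Y)) = 0 := by
  have h1 : (τ + ε) ^ 2 / (a * b) = (τ / X - 2 * (X - Y)) * (τ / Y + 2 * (X - Y)) := by
    rw [← ha, ← hb]; rw [div_mul_div_comm]; ring
  have h2 : (τ + ε) ^ 2 * (1 / a + 1 / b) ^ 2 = (τ / X + τ / Y) ^ 2 := by
    have : τ / X + τ / Y = (τ + ε) / a + (τ + ε) / b := by rw [ha, hb]; ring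
    rw [this]; ring
  have h3 : cubic ε τ a b (τ / (X * Y)) = τ * (τ / (X * Y)) ^ 3
      + (8 * τ - (τ / X - 2 * (X - Y)) * (τ / Y + 2 * (X - Y))) * (τ / (X * Y)) ^ 2
      + (16 * τ - 2 * (τ / X + τ / Y) ^ 2) * (τ / (X * Y)) - 4 * (τ / X + τ / Y) ^ 2 := by
    rw [cubic, h1, ← h2]; ring
  rw [h3]
  field_simp
  ring

/-- The quadratic equation for the coordinate `X` of a critical point with `XY = t`, solved in terms
of the root `τ / t` of the cubic. -/
lemma eq_cubicSol {ε τ a X t : ℝ} (hε : 0 < ε) (hτ : 0 < τ) (ha : 0 < a) (hX : 0 < X)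
    (ht : 0 < t) (h : 2 * X ^ 2 + (τ + ε) / a * X = τ + 2 * t) :
    X = cubicSol ε τ a (τ / t) := by
  have hk : 0 < (τ + ε) / a := by positivity
  have e : cubicSol ε τ a (τ / t) = -((τ + ε) / a / 4)
      + 1 / 2 * Real.sqrt (((τ + ε) / a) ^ 2 / 4 + 4 * (τ / 2 + t)) := by
    have e1 : (τ + ε) / (4 * a) = (τ + ε) / a / 4 := by rw [div_div, mul_comm]
    have e2 : (τ + ε) ^ 2 / (4 * a ^ 2) + 4 * τ * (1 / 2 + 1 / (τ / t))
        = ((τ + ε) / a) ^ 2 / 4 + 4 * (τ / 2 + t) := by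
      rw [div_pow, div_div, mul_comm 4 (a ^ 2), one_div_div, mul_add, mul_assoc 4 τ (t / τ),
        mul_div_cancel₀ t hτ.ne']
      ring
    rw [cubicSol, e1, e2]
  obtain ⟨h1, h2⟩ := quadratic_root (w := τ / 2 + t) hk (by positivity)
  rw [e]
  exact quadratic_root_unique hk hX h1 (by linarith) h2

/-- The minimizer of `g_{ε,τ,+}(·, ·; a, b)`, in both regimes. -/
theorem exists_argminG {ε τ a b : ℝ} (hε : 0 < ε) (hτ : 0 < τ) (ha : 0 < a) (hb : 0 < b) :
    ∃ X Y : ℝ, 0 < X ∧ 0 < Y ∧ argminG ε τ a b = {(X, Y)} ∧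
      (quadSol ε τ a * quadSol ε τ b < ε / 2 → X = quadSol ε τ a ∧ Y = quadSol ε τ b) ∧
      (ε / 2 ≤ quadSol ε τ a * quadSol ε τ b →
        ∃ z : ℝ, {w : ℝ | 0 < w ∧ cubic ε τ a b w = 0} = {z} ∧
          X = cubicSol ε τ a z ∧ Y = cubicSol ε τ b z) := by
  have hq := quadSol_pos hε hτ ha
  have hp := quadSol_pos hε hτ hb
  have hqa := quadSol_critical hε hτ ha
  have hpb := quadSol_critical hε hτ hb
  rcases lt_or_ge (quadSol ε τ a * quadSol ε τ b) (ε / 2) with h | h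
  · exact ⟨_, _, hq, hp, argminG_eq_of_gap hτ hq hp
      fun x y hx hy => gPlus_ge_of_decoupled hε ha hb hq hp hx hy h hqa hpb,
      fun _ => ⟨rfl, rfl⟩, fun h' => absurd h (not_lt.2 h')⟩
  · have hk : 0 < (τ + ε) / a := by positivity
    have hl : 0 < (τ + ε) / b := by positivity
    obtain ⟨X, Y, hX, hY, hXa, hYb⟩ := exists_coupled_critical hk hl hτ
    have hXY := coupled_critical_mem hε hτ hk hl hq hp hX hY hqa hpb hXa hYb h
    have hz : 0 < τ / (X * Y) := by positivity
    have hroot := cubic_of_critical hX hY hXa hYb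
    refine ⟨X, Y, hX, hY, argminG_eq_of_gap hτ hX hY
      fun x y hx hy => gPlus_ge_of_coupled hε ha hb hX hY hx hy hXY hXa hYb,
      fun h' => absurd h' (not_lt.2 h), fun _ => ⟨τ / (X * Y), ?_, ?_, ?_⟩⟩
    · ext w
      constructor
      · rintro ⟨hw, hw'⟩
        exact cubic_positive_root_unique hε hτ ha hb hw hz hw' hroot
      · rintro rfl
        exact ⟨hz, hroot⟩
    · refine eq_cubicSol hε hτ ha hX (mul_pos hX hY) ?_
      rw [hXa]; field_simp; ring
    · refine eq_cubicSol hε hτ hb hY (mul_pos hX hY) ?_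
      rw [hYb]; field_simp; ring

/-! ### The mass -/

lemma klScalar_sub {s t A : ℝ} (hs : 0 < s) (hA : 0 < A) (ht : 0 ≤ t) :
    klScalar s A + (t - s) * (Real.log s - Real.log A) ≤ klScalar t A := by
  rw [klScalar, klScalar]
  rcases ht.lt_or_eq with h | h
  · rw [Real.log_div hs.ne' hA.ne', Real.log_div h.ne' hA.ne']
    have h1 := Real.log_le_sub_one_of_pos (x := s / t) (by positivity)
    rw [Real.log_div hs.ne' h.ne'] at h1
    have h2 := mul_le_mul_of_nonneg_left h1 h.le
    have h3 : t * (s / t - 1) = s - t := by field_simp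
    rw [h3] at h2
    nlinarith
  · rw [← h, Real.log_div hs.ne' hA.ne']
    simp; nlinarith

/-- The squared mass `massSq` minimizes `t ↦ t Υ + τ KL(t ‖ m_μ²) + τ KL(t ‖ m_ν²)
+ ε KL(t ‖ m_μ² m_ν²)`, a convex function whose derivative vanishes there. -/
lemma massSq_minimizes {ε τ mμ mν Υ t : ℝ} (hε : 0 < ε) (hτ : 0 < τ) (hmμ : 0 < mμ)
    (hmν : 0 < mν) (ht : 0 ≤ t) :
    massSq ε τ mμ mν Υ * Υ
        + τ * (klScalar (massSq ε τ mμ mν Υ) (mμ ^ 2) + klScalar (massSq ε τ mμ mν Υ) (mν ^ 2))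
        + ε * klScalar (massSq ε τ mμ mν Υ) (mμ ^ 2 * mν ^ 2)
      ≤ t * Υ + τ * (klScalar t (mμ ^ 2) + klScalar t (mν ^ 2))
        + ε * klScalar t (mμ ^ 2 * mν ^ 2) := by
  have hs : 0 < massSq ε τ mμ mν Υ := by rw [massSq]; positivity
  have hlog : Υ + τ * (Real.log (massSq ε τ mμ mν Υ) - Real.log (mμ ^ 2))
      + τ * (Real.log (massSq ε τ mμ mν Υ) - Real.log (mν ^ 2))
      + ε * (Real.log (massSq ε τ mμ mν Υ) - Real.log (mμ ^ 2 * mν ^ 2)) = 0 := by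
    rw [massSq, Real.log_mul (by positivity) (by positivity),
      Real.log_mul (by positivity) (by positivity), Real.log_mul (by positivity) (by positivity),
      Real.log_rpow hmμ, Real.log_rpow hmν, Real.log_rpow (by positivity), Real.log_exp,
      Real.log_mul (x := mμ ^ 2) (by positivity) (by positivity), Real.log_pow, Real.log_pow,
      Real.log_mul hmμ.ne' hmν.ne']
    field_simp
    push_cast
    ring
  have h1 := mul_le_mul_of_nonneg_left (klScalar_sub hs (A := mμ ^ 2) (by positivity) ht) hτ.le
  have h2 := mul_le_mul_of_nonneg_left (klScalar_sub hs (A := mν ^ 2) (by positivity) ht) hτ.le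
  have h3 := mul_le_mul_of_nonneg_left
    (klScalar_sub hs (A := mμ ^ 2 * mν ^ 2) (by positivity) ht) hε.le
  have h4 := congrArg (fun r => (t - massSq ε τ mμ mν Υ) * r) hlog
  simp only [mul_zero] at h4
  nlinarith

/-! ### Trace inequalities for sorted eigenvalues -/

open Matrix in
/-- Rearrangement inequality for doubly stochastic matrices, from Birkhoff's theorem. -/
lemma sum_doublyStochastic_le {d : ℕ} {D : Matrix (Fin d) (Fin d) ℝ}
    (hD : D ∈ doublyStochastic ℝ (Fin d)) {w a : Fin d → ℝ} (hw : Antitone w) (ha : Antitone a) :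
    ∑ i, ∑ j, w i * (D i j * a j) ≤ ∑ i, w i * a i := by
  obtain ⟨c, hc0, hc1, rfl⟩ := exists_eq_sum_perm_of_mem_doublyStochastic hD
  have h1 : ∀ i j, w i * ((∑ σ : Equiv.Perm (Fin d), c σ • σ.permMatrix ℝ) i j * a j)
      = ∑ σ : Equiv.Perm (Fin d), c σ * (w i * (σ.permMatrix ℝ i j * a j)) := by
    intro i j
    rw [Matrix.sum_apply, Finset.sum_mul, Finset.mul_sum]
    refine Finset.sum_congr rfl fun σ _ => ?_
    rw [Matrix.smul_apply, smul_eq_mul]; ring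
  simp_rw [h1]
  have h2 : ∑ i, ∑ j, ∑ σ : Equiv.Perm (Fin d), c σ * (w i * (σ.permMatrix ℝ i j * a j))
      = ∑ σ : Equiv.Perm (Fin d), c σ * ∑ i, w i * a (σ i) := by
    rw [Finset.sum_congr rfl fun i _ => Finset.sum_comm, Finset.sum_comm]
    refine Finset.sum_congr rfl fun σ _ => ?_
    rw [Finset.mul_sum]
    refine Finset.sum_congr rfl fun i _ => ?_
    simp
  rw [h2]
  calc ∑ σ : Equiv.Perm (Fin d), c σ * ∑ i, w i * a (σ i)
      ≤ ∑ σ : Equiv.Perm (Fin d), c σ * ∑ i, w i * a i := by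
        refine Finset.sum_le_sum fun σ _ => mul_le_mul_of_nonneg_left ?_ (hc0 σ)
        exact (hw.monovary ha).sum_mul_comp_perm_le_sum_mul
    _ = ∑ i, w i * a i := by rw [← Finset.sum_mul, hc1, one_mul]

/-- The eigenvalues of a Hermitian matrix in decreasing order. -/
def sortedEig {d : ℕ} {A : Matrix (Fin d) (Fin d) ℝ} (hA : A.IsHermitian) : Fin d → ℝ :=
  hA.eigenvalues ∘ Tuple.sort (fun i => -hA.eigenvalues i)

lemma sortedEig_antitone {d : ℕ} {A : Matrix (Fin d) (Fin d) ℝ} (hA : A.IsHermitian) :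
    Antitone (sortedEig hA) := fun i j hij => by
  have := Tuple.monotone_sort (fun i => -hA.eigenvalues i) hij
  simp only [Function.comp_apply] at this
  simp only [sortedEig, Function.comp_apply]
  linarith

lemma sortedEig_congr {d : ℕ} {A B : Matrix (Fin d) (Fin d) ℝ} (hA : A.IsHermitian)
    (hB : B.IsHermitian) (h : A.charpoly = B.charpoly) : sortedEig hA = sortedEig hB := by
  have := (Matrix.IsHermitian.eigenvalues_eq_eigenvalues_iff hA hB).2 h
  rw [sortedEig, sortedEig, this]

/-- The spectral theorem with sorted eigenvalues and a real orthogonal matrix. -/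
lemma exists_sorted_diagonalization {d : ℕ} {A : Matrix (Fin d) (Fin d) ℝ} (hA : A.IsHermitian) :
    ∃ U : Matrix (Fin d) (Fin d) ℝ, U * U.transpose = 1 ∧ U.transpose * U = 1 ∧
      A = U * Matrix.diagonal (sortedEig hA) * U.transpose := by
  set W : Matrix (Fin d) (Fin d) ℝ := (hA.eigenvectorUnitary : Matrix (Fin d) (Fin d) ℝ) with hW
  have hspec : A = W * Matrix.diagonal hA.eigenvalues * W.transpose := by
    have h := hA.spectral_theorem
    rw [Unitary.conjStarAlgAut_apply] at h
    rw [← Matrix.conjTranspose_eq_transpose_of_trivial, ← Matrix.star_eq_conjTranspose]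
    simpa using h
  have hWW : W * W.transpose = 1 := by
    rw [← Matrix.conjTranspose_eq_transpose_of_trivial, ← Matrix.star_eq_conjTranspose]
    exact Unitary.coe_mul_star_self hA.eigenvectorUnitary
  set σ := Tuple.sort (fun i => -hA.eigenvalues i) with hσ
  have h1 : W.submatrix id σ * (W.submatrix id σ).transpose = 1 := by
    rw [Matrix.transpose_submatrix, Matrix.submatrix_mul_equiv, hWW, Matrix.submatrix_id_id]
  refine ⟨W.submatrix id σ, h1, mul_eq_one_comm.1 h1, ?_⟩
  have h2 : Matrix.diagonal (sortedEig hA) = (Matrix.diagonal hA.eigenvalues).submatrix σ σ := by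
    rw [Matrix.submatrix_diagonal_equiv]; rfl
  rw [h2, Matrix.submatrix_mul_equiv, Matrix.transpose_submatrix, Matrix.submatrix_mul_equiv,
    ← hspec, Matrix.submatrix_id_id]

lemma sq_mem_doublyStochastic {d : ℕ} {U : Matrix (Fin d) (Fin d) ℝ}
    (h1 : U * U.transpose = 1) (h2 : U.transpose * U = 1) :
    Matrix.of (fun i j => U i j ^ 2) ∈ doublyStochastic ℝ (Fin d) := by
  rw [mem_doublyStochastic_iff_sum]
  refine ⟨fun i j => sq_nonneg _, fun i => ?_, fun j => ?_⟩
  · have := congrFun (congrFun h1 i) i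
    simpa [Matrix.mul_apply, sq] using this
  · have := congrFun (congrFun h2 j) j
    simpa [Matrix.mul_apply, sq] using this

/-- Schur's theorem: the diagonal of a symmetric matrix is majorized by its eigenvalues. -/
lemma sum_mul_diag_le {d : ℕ} {A : Matrix (Fin d) (Fin d) ℝ} (hA : A.IsHermitian)
    {w : Fin d → ℝ} (hw : Antitone w) : ∑ i, w i * A i i ≤ ∑ i, w i * sortedEig hA i := by
  obtain ⟨U, h1, h2, h3⟩ := exists_sorted_diagonalization hA
  refine le_trans (le_of_eq ?_)
    (sum_doublyStochastic_le (sq_mem_doublyStochastic h1 h2) hw (sortedEig_antitone hA))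
  refine Finset.sum_congr rfl fun i _ => ?_
  have : A i i = ∑ j, U i j ^ 2 * sortedEig hA j := by
    conv_lhs => rw [h3]
    rw [Matrix.mul_apply]
    refine Finset.sum_congr rfl fun j _ => ?_
    rw [Matrix.mul_diagonal, Matrix.transpose_apply]; ring
  rw [this, Finset.mul_sum]
  rfl

/-- Abel summation: nonnegative partial sums against nonnegative decreasing weights. -/
lemma abel_sum_nonneg {d : ℕ} {x c : Fin d → ℝ} (hx : Antitone x) (hx0 : ∀ i, 0 ≤ x i)
    (h : ∀ p : ℕ, 0 ≤ ∑ i : Fin d, if (i : ℕ) < p then c i else 0) : 0 ≤ ∑ i, x i * c i := by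
  suffices H : ∀ t : ℝ, (∀ i, t ≤ x i) → t * ∑ i, c i ≤ ∑ i, x i * c i by
    simpa using H 0 hx0
  clear hx0
  induction d with
  | zero => intro t _; simp
  | succ d ih =>
    intro t ht
    rw [Fin.sum_univ_castSucc (f := fun i => x i * c i), Fin.sum_univ_castSucc]
    have h1 := ih (x := fun i => x i.castSucc) (c := fun i => c i.castSucc)
      (fun i j hij => hx (Fin.castSucc_le_castSucc_iff.2 hij)) (fun p => by
        have := h (min p d)
        rw [Fin.sum_univ_castSucc] at this
        simpa using this) (x (Fin.last d)) (fun i => hx (Fin.le_last _))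
    have h2 := h (d + 1)
    rw [Fin.sum_univ_castSucc] at h2
    have h3 : ∀ i : Fin d, (i : ℕ) < d + 1 := fun i => by omega
    simp [h3] at h2
    have h4 := mul_le_mul_of_nonneg_right (ht (Fin.last d)) h2
    linarith

lemma abel_sum_le {d : ℕ} {x a b : Fin d → ℝ} (hx : Antitone x) (hx0 : ∀ i, 0 ≤ x i)
    (h : ∀ p : ℕ, (∑ i : Fin d, if (i : ℕ) < p then a i else 0)
      ≤ ∑ i : Fin d, if (i : ℕ) < p then b i else 0) :
    ∑ i, x i * a i ≤ ∑ i, x i * b i := by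
  have := abel_sum_nonneg (c := fun i => b i - a i) hx hx0 (fun p => by
    have := sub_nonneg.2 (h p)
    rw [← Finset.sum_sub_distrib] at this
    refine this.trans_eq (Finset.sum_congr rfl fun i _ => ?_)
    split_ifs <;> ring)
  simp_rw [mul_sub] at this
  rw [Finset.sum_sub_distrib] at this
  linarith

/-- Abel summation in two variables, from the comparison of all corner sums. -/
lemma abel_sum_le_two {d : ℕ} {x y : Fin d → ℝ} {D E : Fin d → Fin d → ℝ}
    (hx : Antitone x) (hx0 : ∀ i, 0 ≤ x i) (hy : Antitone y) (hy0 : ∀ i, 0 ≤ y i)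
    (h : ∀ p q : ℕ, (∑ i : Fin d, if (i : ℕ) < p then
        (∑ j : Fin d, if (j : ℕ) < q then D i j else 0) else 0)
      ≤ ∑ i : Fin d, if (i : ℕ) < p then
        (∑ j : Fin d, if (j : ℕ) < q then E i j else 0) else 0) :
    ∑ i, ∑ j, x i * y j * D i j ≤ ∑ i, ∑ j, x i * y j * E i j := by
  have swap : ∀ F : Fin d → Fin d → ℝ, ∑ i, ∑ j, x i * y j * F i j
      = ∑ j, y j * ∑ i, x i * F i j := by
    intro F
    rw [Finset.sum_comm]
    refine Finset.sum_congr rfl fun j _ => ?_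
    rw [Finset.mul_sum]
    exact Finset.sum_congr rfl fun i _ => by ring
  rw [swap, swap]
  refine abel_sum_le hy hy0 fun q => ?_
  have swap2 : ∀ F : Fin d → Fin d → ℝ,
      (∑ j : Fin d, if (j : ℕ) < q then ∑ i, x i * F i j else 0)
        = ∑ i, x i * ∑ j : Fin d, if (j : ℕ) < q then F i j else 0 := by
    intro F
    simp_rw [Finset.mul_sum]
    rw [Finset.sum_comm]
    refine Finset.sum_congr rfl fun j _ => ?_
    split_ifs with hj
    · rfl
    · simp
  rw [swap2, swap2]
  exact abel_sum_le hx hx0 fun p => h p q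

lemma isHermitian_mul_transpose {ι κ : Type*} [Fintype κ] (C : Matrix ι κ ℝ) :
    (C * C.transpose).IsHermitian := by
  have := Matrix.isHermitian_mul_conjTranspose_self C
  rwa [Matrix.conjTranspose_eq_transpose_of_trivial] at this

lemma sortedEig_mul_transpose_nonneg {d : ℕ} (C : Matrix (Fin d) (Fin d) ℝ) (i : Fin d) :
    0 ≤ sortedEig (isHermitian_mul_transpose C) i := by
  have h := Matrix.posSemidef_self_mul_conjTranspose C
  rw [Matrix.conjTranspose_eq_transpose_of_trivial] at h
  exact h.eigenvalues_nonneg _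

lemma corner_sum_le {d : ℕ} (C : Matrix (Fin d) (Fin d) ℝ) (p : ℕ) :
    (∑ i : Fin d, if (i : ℕ) < p then ∑ j, C i j ^ 2 else 0)
      ≤ ∑ i : Fin d, if (i : ℕ) < p then sortedEig (isHermitian_mul_transpose C) i else 0 := by
  have hw : Antitone (fun i : Fin d => if (i : ℕ) < p then (1 : ℝ) else 0) := by
    intro i j hij
    have hij' : (i : ℕ) ≤ j := hij
    simp only
    split_ifs with h1 h2 <;> first | omega | norm_num
  have h := sum_mul_diag_le (isHermitian_mul_transpose C) hw
  simpa [Matrix.mul_apply, sq] using h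

/-- A trace inequality of von Neumann type: for decreasing nonnegative weights, the weighted sum of
the squares of the entries of `C` is largest when `C` is diagonal with sorted singular values. -/
lemma sum_weighted_sq_le {d : ℕ} (C : Matrix (Fin d) (Fin d) ℝ) {x y : Fin d → ℝ}
    (hx : Antitone x) (hx0 : ∀ i, 0 ≤ x i) (hy : Antitone y) (hy0 : ∀ i, 0 ≤ y i) :
    ∑ i, ∑ j, x i * y j * C i j ^ 2
      ≤ ∑ i, x i * y i * sortedEig (isHermitian_mul_transpose C) i := by
  set σ := sortedEig (isHermitian_mul_transpose C) with hσ
  have hσ' : sortedEig (isHermitian_mul_transpose C.transpose) = σ := by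
    refine sortedEig_congr _ _ ?_
    rw [Matrix.transpose_transpose, Matrix.charpoly_mul_comm]
  have hrow := corner_sum_le C
  have hcol := corner_sum_le C.transpose
  rw [hσ'] at hcol
  rw [← hσ] at hrow
  have hE : ∑ i, x i * y i * σ i = ∑ i, ∑ j, x i * y j * (if i = j then σ i else 0) := by
    refine Finset.sum_congr rfl fun i _ => ?_
    simp
  rw [hE]
  refine abel_sum_le_two hx hx0 hy hy0 fun p q => ?_
  have hR : ∀ i : Fin d, (∑ j : Fin d, if (j : ℕ) < q then (if i = j then σ i else 0) else 0)
      = if (i : ℕ) < q then σ i else 0 := by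
    intro i
    rw [Finset.sum_eq_single i]
    · simp
    · intro j _ hj
      simp [hj.symm]
    · simp
  simp_rw [hR]
  rcases le_total p q with hpq | hpq
  · calc _ ≤ ∑ i : Fin d, (if (i : ℕ) < p then ∑ j, C i j ^ 2 else 0) := by
          refine Finset.sum_le_sum fun i _ => ?_
          split_ifs
          · refine Finset.sum_le_sum fun j _ => ?_
            split_ifs
            · exact le_rfl
            · positivity
          · exact le_rfl
      _ ≤ _ := hrow p
      _ = _ := by
          refine Finset.sum_congr rfl fun i _ => ?_
          split_ifs <;> first | rfl | omega
  · calc _ ≤ ∑ i : Fin d, ∑ j : Fin d, (if (j : ℕ) < q then C i j ^ 2 else 0) := by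
          refine Finset.sum_le_sum fun i _ => ?_
          split_ifs
          · exact le_rfl
          · exact Finset.sum_nonneg fun j _ => by split_ifs <;> positivity
      _ = ∑ j : Fin d, (if (j : ℕ) < q then ∑ i, C.transpose j i ^ 2 else 0) := by
          rw [Finset.sum_comm]
          refine Finset.sum_congr rfl fun j _ => ?_
          split_ifs <;> simp
      _ ≤ _ := hcol q
      _ = _ := by
          refine Finset.sum_congr rfl fun i _ => ?_
          split_ifs <;> first | rfl | omega

/-! ### The finite-dimensional problem over covariance matrices -/

/-- The objective at the centred Gaussian probability measure with covariance `[X, K; Kᵀ, Y]`, the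
reference measures being `N(0, diag lμ)` and `N(0, diag lν)`. The factor `1/2` in the divergence of
Gaussian measures is cancelled by the doubling in the quadratic divergence. -/
def covCost {m n : ℕ} (ε τ : ℝ) (lμ : Fin m → ℝ) (lν : Fin n → ℝ) (X : Matrix (Fin m) (Fin m) ℝ)
    (K : Matrix (Fin m) (Fin n) ℝ) (Y : Matrix (Fin n) (Fin n) ℝ) : ℝ :=
  ∑ i, ∑ j, X i j ^ 2 + ∑ i, ∑ j, Y i j ^ 2 - 2 * ∑ i, ∑ j, K i j ^ 2
    + (τ + ε) * (∑ i, (X i i / lμ i - 1 + Real.log (lμ i))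
      + ∑ j, (Y j j / lν j - 1 + Real.log (lν j)))
    - τ * Real.log X.det - τ * Real.log Y.det
    - ε * Real.log (Matrix.fromBlocks X K K.transpose Y).det

lemma sum_castLE_add_sum_filter {m n : ℕ} (hnm : n ≤ m) (F : Fin m → ℝ) :
    ∑ k : Fin n, F (Fin.castLE hnm k)
      + ∑ k ∈ Finset.univ.filter (fun k : Fin m => n ≤ (k : ℕ)), F k = ∑ k, F k := by
  obtain ⟨d, rfl⟩ := Nat.exists_eq_add_of_le hnm
  rw [Finset.sum_filter, Fin.sum_univ_add, Fin.sum_univ_add]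
  have h1 : ∀ i : Fin n, ¬ (n ≤ ((Fin.castAdd d i : Fin (n + d)) : ℕ)) := fun i => by simp
  simp only [h1, if_false, Finset.sum_const_zero, zero_add]
  congr 1
  exact Finset.sum_congr rfl fun i _ => by simp

lemma upsilon_eq {m n : ℕ} (hnm : n ≤ m) {ε τ : ℝ} {lμ : Fin m → ℝ} {lν : Fin n → ℝ}
    (hlμ : ∀ i, 0 < lμ i) (hlν : ∀ j, 0 < lν j) {x : Fin m → ℝ} {y : Fin n → ℝ}
    (hx : ∀ i, 0 < x i) (hy : ∀ j, 0 < y j) :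
    upsilon hnm ε τ lμ lν x y = ∑ i, x i ^ 2 + ∑ j, y j ^ 2
      + (τ + ε) * (∑ i, (x i / lμ i - 1 + Real.log (lμ i)) + ∑ j, (y j / lν j - 1 + Real.log (lν j)))
      - (τ + ε) * (∑ i, Real.log (x i) + ∑ j, Real.log (y j))
      + ∑ k : Fin n, crossTerm ε (x (Fin.castLE hnm k) * y k) := by
  have hh : ∀ k, hFun ε τ (x k) (lμ k) = x k ^ 2
      + (τ + ε) * (x k / lμ k - 1 + Real.log (lμ k)) - (τ + ε) * Real.log (x k) := by
    intro k
    rw [hFun, Real.log_div (hx k).ne' (hlμ k).ne']; ring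
  have hg : ∀ k : Fin n,
      gPlus ε τ (x (Fin.castLE hnm k)) (y k) (lμ (Fin.castLE hnm k)) (lν k)
      = hFun ε τ (x (Fin.castLE hnm k)) (lμ (Fin.castLE hnm k))
        + (y k ^ 2 + (τ + ε) * (y k / lν k - 1 + Real.log (lν k)) - (τ + ε) * Real.log (y k)
          + crossTerm ε (x (Fin.castLE hnm k) * y k)) := by
    intro k
    rw [gPlus_eq (hx _) (hy k) (hlμ _) (hlν k), hh]; ring
  rw [upsilon]
  simp_rw [hg]
  rw [Finset.sum_add_distrib, add_right_comm, sum_castLE_add_sum_filter hnm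
    (fun k => hFun ε τ (x k) (lμ k))]
  simp_rw [hh]
  simp only [Finset.sum_add_distrib, Finset.sum_sub_distrib, ← Finset.mul_sum]
  ring

lemma sum_sq_eq_trace {ι κ : Type*} [Fintype ι] [Fintype κ] (A : Matrix ι κ ℝ) :
    ∑ i, ∑ j, A i j ^ 2 = (A * A.transpose).trace := by
  simp [Matrix.trace, Matrix.mul_apply, sq]

lemma sum_sq_orthogonal {ι κ : Type*} [Fintype ι] [Fintype κ] [DecidableEq ι] [DecidableEq κ]
    {U : Matrix ι ι ℝ} {V : Matrix κ κ ℝ} (hU : U.transpose * U = 1) (hV : V.transpose * V = 1)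
    (A : Matrix ι κ ℝ) :
    ∑ i, ∑ j, (U * A * V.transpose) i j ^ 2 = ∑ i, ∑ j, A i j ^ 2 := by
  rw [sum_sq_eq_trace, sum_sq_eq_trace]
  have : U * A * V.transpose * (U * A * V.transpose).transpose
      = U * (A * A.transpose) * U.transpose := by
    simp only [Matrix.transpose_mul, Matrix.transpose_transpose]
    calc _ = U * A * (V.transpose * V) * (A.transpose * U.transpose) := by
          simp only [Matrix.mul_assoc]
      _ = _ := by rw [hV, Matrix.mul_one]; simp only [Matrix.mul_assoc]
  rw [this, Matrix.mul_assoc, Matrix.trace_mul_comm, Matrix.mul_assoc, hU, Matrix.mul_one]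

lemma sum_dite_lt {m n : ℕ} (hnm : n ≤ m) (F : Fin n → ℝ) :
    ∑ k : Fin m, (if h : (k : ℕ) < n then F ⟨k, h⟩ else 0) = ∑ k, F k := by
  rw [← sum_castLE_add_sum_filter hnm]
  have h1 : ∑ k ∈ Finset.univ.filter (fun k : Fin m => n ≤ (k : ℕ)),
      (if h : (k : ℕ) < n then F ⟨k, h⟩ else 0) = 0 :=
    Finset.sum_eq_zero fun k hk => by
      have := (Finset.mem_filter.1 hk).2
      rw [dif_neg (by omega)]
  rw [h1, add_zero]
  exact Finset.sum_congr rfl fun k _ => by simp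

/-- The coupling terms for normalized marginals: `x`, `y` are the variances and `C` is the matrix
of correlations. -/
lemma correlation_bound {m n : ℕ} (hnm : n ≤ m) {ε : ℝ} (hε : 0 < ε)
    {x : Fin m → ℝ} {y : Fin n → ℝ} (hx : Antitone x) (hy : Antitone y)
    (hx0 : ∀ i, 0 < x i) (hy0 : ∀ j, 0 < y j) (C : Matrix (Fin m) (Fin n) ℝ)
    (hC : (1 - C * C.transpose).PosDef) :
    ∑ k : Fin n, crossTerm ε (x (Fin.castLE hnm k) * y k)
      ≤ -2 * ∑ i, ∑ j, x i * y j * C i j ^ 2 - ε * Real.log (1 - C * C.transpose).det := by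
  -- `C` and `y` are extended by zero to square size, which does not change `C Cᵀ`
  let C' : Matrix (Fin m) (Fin m) ℝ :=
    Matrix.of fun i j => if h : (j : ℕ) < n then C i ⟨j, h⟩ else 0
  let y' : Fin m → ℝ := fun j => if h : (j : ℕ) < n then y ⟨j, h⟩ else 0
  have hCC : C' * C'.transpose = C * C.transpose := by
    ext i j
    rw [Matrix.mul_apply, Matrix.mul_apply, ← sum_dite_lt hnm]
    refine Finset.sum_congr rfl fun k _ => ?_
    simp only [C', Matrix.transpose_apply, Matrix.of_apply]
    split_ifs <;> simp
  have hy' : Antitone y' := by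
    intro i j hij
    have hij' : (i : ℕ) ≤ j := hij
    simp only [y']
    split_ifs with h1 h2
    · exact hy hij'
    · omega
    · exact (hy0 _).le
    · exact le_rfl
  have hy0' : ∀ j, 0 ≤ y' j := by
    intro j
    simp only [y']
    split_ifs
    · exact (hy0 _).le
    · exact le_rfl
  have hN := sum_weighted_sq_le C' hx (fun i => (hx0 i).le) hy' hy0'
  set σ := sortedEig (isHermitian_mul_transpose C') with hσ
  have hσ0 : ∀ i, 0 ≤ σ i := sortedEig_mul_transpose_nonneg C'
  obtain ⟨U, hU1, hU2, hU3⟩ := exists_sorted_diagonalization (isHermitian_mul_transpose C')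
  rw [← hσ, hCC] at hU3
  have hdiag : U.transpose * (1 - C * C.transpose) * U = Matrix.diagonal (fun i => 1 - σ i) := by
    rw [hU3, Matrix.mul_sub, Matrix.sub_mul, Matrix.mul_one, hU2]
    calc _ = 1 - (U.transpose * U) * Matrix.diagonal σ * (U.transpose * U) := by
          simp only [Matrix.mul_assoc]
      _ = _ := by
          rw [hU2, Matrix.one_mul, Matrix.mul_one, ← Matrix.diagonal_one, Matrix.diagonal_sub]
  have hσ1 : ∀ i, σ i < 1 := by
    have h1 : (U.transpose * (1 - C * C.transpose) * U).PosDef := by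
      have := hC.conjTranspose_mul_mul_same (B := U)
        (Matrix.mulVec_injective_of_isUnit (IsUnit.of_mul_eq_one _ hU1))
      rwa [Matrix.conjTranspose_eq_transpose_of_trivial] at this
    rw [hdiag, Matrix.posDef_diagonal_iff] at h1
    intro i
    have := h1 i
    linarith
  have hdet : (1 - C * C.transpose).det = ∏ i, (1 - σ i) := by
    rw [← Matrix.det_diagonal, ← hdiag, Matrix.mul_assoc, Matrix.det_mul_comm, Matrix.mul_assoc,
      hU1, Matrix.mul_one]
  have hlog : Real.log (1 - C * C.transpose).det = ∑ i, Real.log (1 - σ i) := by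
    rw [hdet, Real.log_prod]
    intro i _
    have := hσ1 i
    linarith
  have hL : ∑ i, ∑ j, x i * y' j * C' i j ^ 2 = ∑ i, ∑ j, x i * y j * C i j ^ 2 := by
    refine Finset.sum_congr rfl fun i _ => ?_
    rw [← sum_dite_lt hnm]
    refine Finset.sum_congr rfl fun j _ => ?_
    simp only [C', y', Matrix.of_apply]
    split_ifs <;> simp
  have hR : ∑ i, x i * y' i * σ i
      = ∑ k : Fin n, x (Fin.castLE hnm k) * y k * σ (Fin.castLE hnm k) := by
    rw [← sum_dite_lt hnm]
    refine Finset.sum_congr rfl fun j _ => ?_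
    simp only [y']
    split_ifs
    · rfl
    · simp
  rw [hL, hR] at hN
  have hlog' : ∑ i, Real.log (1 - σ i) ≤ ∑ k : Fin n, Real.log (1 - σ (Fin.castLE hnm k)) := by
    rw [← sum_castLE_add_sum_filter hnm]
    have : ∑ k ∈ Finset.univ.filter (fun k : Fin m => n ≤ (k : ℕ)), Real.log (1 - σ k) ≤ 0 := by
      refine Finset.sum_nonpos fun k _ => Real.log_nonpos ?_ ?_
      · have := hσ1 k; linarith
      · have := hσ0 k; linarith
    linarith
  have hk : ∑ k : Fin n, crossTerm ε (x (Fin.castLE hnm k) * y k)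
      ≤ ∑ k : Fin n, (-2 * (x (Fin.castLE hnm k) * y k) * σ (Fin.castLE hnm k)
        - ε * Real.log (1 - σ (Fin.castLE hnm k))) :=
    Finset.sum_le_sum fun k _ => crossTerm_le hε (mul_pos (hx0 _) (hy0 _)) (hσ0 _) (hσ1 _)
  rw [Finset.sum_sub_distrib, ← Finset.mul_sum] at hk
  have hk2 : ∑ k : Fin n, -2 * (x (Fin.castLE hnm k) * y k) * σ (Fin.castLE hnm k)
      = -2 * ∑ k : Fin n, x (Fin.castLE hnm k) * y k * σ (Fin.castLE hnm k) := by
    rw [Finset.mul_sum]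
    exact Finset.sum_congr rfl fun k _ => by ring
  rw [hk2] at hk
  rw [hlog]
  have := mul_le_mul_of_nonneg_left hlog' hε.le
  linarith

open Matrix in
lemma posDef_of_fromBlocks_one {m n : ℕ} {C : Matrix (Fin m) (Fin n) ℝ}
    (h : (fromBlocks 1 C Cᵀ 1).PosDef) : (1 - C * Cᵀ).PosDef := by
  have h1 := h.conjTranspose_mul_mul_same (B := fromRows (1 : Matrix (Fin m) (Fin m) ℝ) (-Cᵀ)) (by
    intro u v huv
    rw [fromRows_mulVec, fromRows_mulVec] at huv
    funext i
    simpa using congrFun huv (Sum.inl i))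
  convert h1 using 1
  rw [conjTranspose_eq_transpose_of_trivial, transpose_fromRows, Matrix.mul_assoc,
    fromBlocks_mul_fromRows, fromCols_mul_fromRows]
  simp [sub_eq_add_neg]

/-- The cost of a covariance matrix is at least a sum of scalar costs: marginal covariances may be
replaced by their sorted spectra, and the cross-covariance by a diagonal one. -/
theorem exists_upsilon_le_covCost {m n : ℕ} (hnm : n ≤ m) {ε τ : ℝ} (hε : 0 < ε) (hτ : 0 < τ)
    {lμ : Fin m → ℝ} {lν : Fin n → ℝ} (hlμ : ∀ i, 0 < lμ i) (hlν : ∀ j, 0 < lν j)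
    (hlμ_anti : Antitone lμ) (hlν_anti : Antitone lν)
    {X : Matrix (Fin m) (Fin m) ℝ} {K : Matrix (Fin m) (Fin n) ℝ} {Y : Matrix (Fin n) (Fin n) ℝ}
    (hX : X.PosDef) (hY : Y.PosDef) (hT : (Matrix.fromBlocks X K K.transpose Y).PosDef) :
    ∃ (x : Fin m → ℝ) (y : Fin n → ℝ), (∀ i, 0 < x i) ∧ (∀ j, 0 < y j) ∧
      upsilon hnm ε τ lμ lν x y ≤ covCost ε τ lμ lν X K Y := by
  set x := sortedEig hX.isHermitian with hx
  set y := sortedEig hY.isHermitian with hy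
  have hx0 : ∀ i, 0 < x i := fun i => hX.eigenvalues_pos _
  have hy0 : ∀ j, 0 < y j := fun j => hY.eigenvalues_pos _
  obtain ⟨U, hU1, hU2, hU3⟩ := exists_sorted_diagonalization hX.isHermitian
  obtain ⟨V, hV1, hV2, hV3⟩ := exists_sorted_diagonalization hY.isHermitian
  rw [← hx] at hU3
  rw [← hy] at hV3
  have hxx : ∀ i, Real.sqrt (x i) * Real.sqrt (x i) = x i := fun i =>
    Real.mul_self_sqrt (hx0 i).le
  have hyy : ∀ i, Real.sqrt (y i) * Real.sqrt (y i) = y i := fun i =>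
    Real.mul_self_sqrt (hy0 i).le
  have hsx : ∀ i, 0 < Real.sqrt (x i) := fun i => Real.sqrt_pos.2 (hx0 i)
  have hsy : ∀ i, 0 < Real.sqrt (y i) := fun i => Real.sqrt_pos.2 (hy0 i)
  set A := Matrix.diagonal (fun i => Real.sqrt (x i)) with hA
  set B := Matrix.diagonal (fun j => Real.sqrt (y j)) with hB
  set A' := Matrix.diagonal (fun i => (Real.sqrt (x i))⁻¹) with hA'
  set B' := Matrix.diagonal (fun j => (Real.sqrt (y j))⁻¹) with hB'
  have hAA : A * A = Matrix.diagonal x := by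
    rw [hA, Matrix.diagonal_mul_diagonal]; simp_rw [hxx]
  have hBB : B * B = Matrix.diagonal y := by
    rw [hB, Matrix.diagonal_mul_diagonal]; simp_rw [hyy]
  have hAA' : A * A' = 1 := by
    rw [hA, hA', Matrix.diagonal_mul_diagonal, ← Matrix.diagonal_one]
    congr 1; funext i; exact mul_inv_cancel₀ (hsx i).ne'
  have hBB' : B' * B = 1 := by
    rw [hB, hB', Matrix.diagonal_mul_diagonal, ← Matrix.diagonal_one]
    congr 1; funext i; exact inv_mul_cancel₀ (hsy i).ne'
  have hAt : A.transpose = A := Matrix.diagonal_transpose _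
  have hBt : B.transpose = B := Matrix.diagonal_transpose _
  set C : Matrix (Fin m) (Fin n) ℝ := A' * (U.transpose * K * V) * B' with hC
  have hACB : A * C * B = U.transpose * K * V := by
    calc A * C * B = (A * A') * (U.transpose * K * V) * (B' * B) := by
          rw [hC]; simp only [Matrix.mul_assoc]
      _ = _ := by rw [hAA', hBB', Matrix.one_mul, Matrix.mul_one]
  have hK : K = U * (A * C * B) * V.transpose := by
    rw [hACB]
    calc K = (U * U.transpose) * K * (V * V.transpose) := by
          rw [hU1, hV1, Matrix.one_mul, Matrix.mul_one]
      _ = _ := by simp only [Matrix.mul_assoc]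
  set M := Matrix.fromBlocks (U * A) 0 0 (V * B) with hM
  set T' := Matrix.fromBlocks 1 C C.transpose 1 with hT'
  have hXA : U * A * (U * A).transpose = X := by
    rw [hU3, ← hAA, Matrix.transpose_mul, hAt]; simp only [Matrix.mul_assoc]
  have hYB : V * B * (V * B).transpose = Y := by
    rw [hV3, ← hBB, Matrix.transpose_mul, hBt]; simp only [Matrix.mul_assoc]
  have hTM : Matrix.fromBlocks X K K.transpose Y = M * T' * M.transpose := by
    have hK' : U * A * C * (V * B).transpose = K := by
      rw [hK, Matrix.transpose_mul, hBt]; simp only [Matrix.mul_assoc]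
    have hK'' : V * B * C.transpose * (U * A).transpose = K.transpose := by
      rw [← hK']; simp only [Matrix.transpose_mul, Matrix.transpose_transpose, Matrix.mul_assoc]
    rw [hM, hT', Matrix.fromBlocks_transpose, Matrix.fromBlocks_multiply,
      Matrix.fromBlocks_multiply]
    simp only [Matrix.mul_one, Matrix.zero_mul, Matrix.mul_zero, add_zero, zero_add,
      Matrix.transpose_zero, hXA, hYB, hK', hK'']
  have hdet : (Matrix.fromBlocks X K K.transpose Y).det
      = X.det * Y.det * (1 - C * C.transpose).det := by
    rw [hTM, Matrix.det_mul, Matrix.det_mul, Matrix.det_transpose, hM,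
      Matrix.det_fromBlocks_zero₂₁, hT', Matrix.det_fromBlocks_one₂₂, ← hXA, ← hYB,
      Matrix.det_mul (U * A), Matrix.det_mul (V * B), Matrix.det_transpose, Matrix.det_transpose]
    ring
  have hT'pd : T'.PosDef := by
    have hMu : IsUnit M := by
      rw [Matrix.isUnit_iff_isUnit_det, isUnit_iff_ne_zero]
      intro h0
      have := hT.det_pos
      rw [hTM, Matrix.det_mul, Matrix.det_mul, h0] at this
      simp at this
    rw [hTM, ← Matrix.conjTranspose_eq_transpose_of_trivial, ← Matrix.star_eq_conjTranspose] at hT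
    exact (Matrix.IsUnit.posDef_star_right_conjugate_iff hMu).1 hT
  have hCpd := posDef_of_fromBlocks_one hT'pd
  have hmain := correlation_bound hnm hε (sortedEig_antitone _) (sortedEig_antitone _) hx0 hy0 C hCpd
  have hXsq : ∑ i, ∑ j, X i j ^ 2 = ∑ i, x i ^ 2 := by
    rw [hU3, sum_sq_orthogonal hU2 hU2]
    exact Finset.sum_congr rfl fun i _ => by simp [Matrix.diagonal_apply]
  have hYsq : ∑ i, ∑ j, Y i j ^ 2 = ∑ i, y i ^ 2 := by
    rw [hV3, sum_sq_orthogonal hV2 hV2]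
    exact Finset.sum_congr rfl fun i _ => by simp [Matrix.diagonal_apply]
  have hKsq : ∑ i, ∑ j, K i j ^ 2 = ∑ i, ∑ j, x i * y j * C i j ^ 2 := by
    rw [hK, sum_sq_orthogonal hU2 hV2]
    refine Finset.sum_congr rfl fun i _ => Finset.sum_congr rfl fun j _ => ?_
    rw [hA, hB, Matrix.mul_diagonal, Matrix.diagonal_mul, mul_pow, mul_pow,
      Real.sq_sqrt (hx0 i).le, Real.sq_sqrt (hy0 j).le]
    ring
  have hXdet : Real.log X.det = ∑ i, Real.log (x i) := by
    have : X.det = ∏ i, x i := by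
      rw [hU3, Matrix.mul_assoc, Matrix.det_mul_comm, Matrix.mul_assoc, hU2, Matrix.mul_one,
        Matrix.det_diagonal]
    rw [this, Real.log_prod fun i _ => (hx0 i).ne']
  have hYdet : Real.log Y.det = ∑ i, Real.log (y i) := by
    have : Y.det = ∏ i, y i := by
      rw [hV3, Matrix.mul_assoc, Matrix.det_mul_comm, Matrix.mul_assoc, hV2, Matrix.mul_one,
        Matrix.det_diagonal]
    rw [this, Real.log_prod fun i _ => (hy0 i).ne']
  have hwt : ∀ {d : ℕ} {l : Fin d → ℝ}, (∀ i, 0 < l i) → Antitone l →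
      Antitone (fun i => -(l i)⁻¹) := fun hl hanti i j hij =>
    neg_le_neg (inv_anti₀ (hl _) (hanti hij))
  have hXtr : ∑ i, x i / lμ i ≤ ∑ i, X i i / lμ i := by
    have := sum_mul_diag_le hX.isHermitian (hwt hlμ hlμ_anti)
    simp only [neg_mul, Finset.sum_neg_distrib, neg_le_neg_iff] at this
    simpa [div_eq_inv_mul] using this
  have hYtr : ∑ i, y i / lν i ≤ ∑ i, Y i i / lν i := by
    have := sum_mul_diag_le hY.isHermitian (hwt hlν hlν_anti)
    simp only [neg_mul, Finset.sum_neg_distrib, neg_le_neg_iff] at this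
    simpa [div_eq_inv_mul] using this
  refine ⟨x, y, hx0, hy0, ?_⟩
  rw [upsilon_eq hnm hlμ hlν hx0 hy0, covCost, hdet,
    Real.log_mul (mul_ne_zero hX.det_pos.ne' hY.det_pos.ne') hCpd.det_pos.ne',
    Real.log_mul hX.det_pos.ne' hY.det_pos.ne', hXsq, hYsq, hKsq, hXdet, hYdet]
  simp only [Finset.sum_add_distrib, Finset.sum_sub_distrib]
  have h1 := mul_le_mul_of_nonneg_left hXtr (add_pos hτ hε).le
  have h2 := mul_le_mul_of_nonneg_left hYtr (add_pos hτ hε).le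
  linarith

/-! ### A variational inequality for the quadratic Kullback-Leibler divergence -/

lemma klFun_ge {r t : ℝ} (hr : 0 ≤ r) : r * t - Real.exp t + 1 ≤ klFun r := by
  rw [klFun_apply]
  rcases hr.eq_or_lt with rfl | hr
  · simp; positivity
  · have h := Real.add_one_le_exp (t - Real.log r)
    have h2 : Real.exp (t - Real.log r) = Real.exp t / r := by
      rw [Real.exp_sub, Real.exp_log hr]
    rw [h2, le_div_iff₀ hr] at h
    nlinarith

section klDiv

variable {X : Type*} [MeasurableSpace X]

/-- The Donsker-Varadhan inequality in its form for finite measures. -/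
lemma integral_sub_le_klDiv {P Q : Measure X} [IsFiniteMeasure P] [IsFiniteMeasure Q]
    {f : X → ℝ} (hfP : Integrable f P) (hfQ : Integrable (fun x => Real.exp (f x)) Q)
    (hKL : klDiv P Q ≠ ∞) :
    ∫ x, f x ∂P - ∫ x, Real.exp (f x) ∂Q + Q.real Set.univ ≤ (klDiv P Q).toReal := by
  obtain ⟨hac, hllr⟩ := klDiv_ne_top_iff.1 hKL
  rw [toReal_klDiv_eq_integral_klFun hac]
  have h1 : Integrable (fun x => (P.rnDeriv Q x).toReal * f x) Q :=
    (integrable_toReal_rnDeriv_mul_iff hac).2 hfP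
  have h2 : ∫ x, ((P.rnDeriv Q x).toReal * f x - Real.exp (f x) + 1) ∂Q
      = ∫ x, f x ∂P - ∫ x, Real.exp (f x) ∂Q + Q.real Set.univ := by
    rw [integral_add (f := fun x => (P.rnDeriv Q x).toReal * f x - Real.exp (f x))
      (h1.sub hfQ) (integrable_const _), integral_sub h1 hfQ,
      integral_toReal_rnDeriv_mul hac]
    simp
  rw [← h2]
  exact integral_mono ((h1.sub hfQ).add (integrable_const _))
    ((integrable_klFun_rnDeriv_iff hac).2 hllr) fun x => klFun_ge ENNReal.toReal_nonneg

lemma klDiv_withDensity_exp {Q : Measure X} [IsFiniteMeasure Q] {f : X → ℝ} (hf : Measurable f)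
    {P : Measure X} [IsFiniteMeasure P]
    (hP : P = Q.withDensity (fun x => ENNReal.ofReal (Real.exp (f x)))) (hfP : Integrable f P) :
    klDiv P Q ≠ ∞ ∧
      (klDiv P Q).toReal = ∫ x, f x ∂P - P.real Set.univ + Q.real Set.univ := by
  have hac : P ≪ Q := by rw [hP]; exact withDensity_absolutelyContinuous _ _
  have hllr : llr P Q =ᵐ[P] f := by
    refine hac.ae_le ?_
    have h := Measure.rnDeriv_withDensity Q
      (show Measurable fun x => ENNReal.ofReal (Real.exp (f x)) by fun_prop)
    rw [← hP] at h
    filter_upwards [h] with x hx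
    rw [llr, hx, ENNReal.toReal_ofReal (Real.exp_pos _).le, Real.log_exp]
  have hint : Integrable (llr P Q) P := hfP.congr hllr.symm
  refine ⟨klDiv_ne_top hac hint, ?_⟩
  rw [toReal_klDiv hac hint, integral_congr_ae hllr]
  ring

lemma integral_fst_add_snd {α : Measure X} [IsFiniteMeasure α] {F : X → ℝ} (hF : Integrable F α) :
    Integrable (fun z : X × X => F z.1 + F z.2) (α.prod α) ∧
      ∫ z, (F z.1 + F z.2) ∂(α.prod α) = 2 * α.real Set.univ * ∫ x, F x ∂α := by
  have h1 : Integrable (fun z : X × X => F z.1) (α.prod α) := hF.comp_fst α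
  have h2 : Integrable (fun z : X × X => F z.2) (α.prod α) := hF.comp_snd α
  refine ⟨h1.add h2, ?_⟩
  rw [integral_add h1 h2, integral_fun_fst, integral_fun_snd]
  simp only [smul_eq_mul]
  ring

lemma real_prod_univ (α : Measure X) [IsFiniteMeasure α] :
    (α.prod α).real Set.univ = α.real Set.univ ^ 2 := by
  rw [← Set.univ_prod_univ, measureReal_prod_prod, sq]

/-- The variational inequality for `klQuad`, with test functions `F(z) + F(z')`. -/
lemma le_klQuad {α β : Measure X} [IsFiniteMeasure α] [IsFiniteMeasure β] {F : X → ℝ}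
    (hFα : Integrable F α) (hFβ : Integrable (fun x => Real.exp (F x)) β)
    (hKL : klQuad α β ≠ ∞) :
    2 * α.real Set.univ * ∫ x, F x ∂α - (∫ x, Real.exp (F x) ∂β) ^ 2 + β.real Set.univ ^ 2
      ≤ (klQuad α β).toReal := by
  obtain ⟨h1, h2⟩ := integral_fst_add_snd hFα
  have h3 : Integrable (fun z : X × X => Real.exp (F z.1 + F z.2)) (β.prod β) := by
    simp_rw [Real.exp_add]
    exact hFβ.mul_prod hFβ
  have h4 : ∫ z, Real.exp (F z.1 + F z.2) ∂(β.prod β) = (∫ x, Real.exp (F x) ∂β) ^ 2 := by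
    simp_rw [Real.exp_add]
    rw [integral_prod_mul (fun x => Real.exp (F x)) (fun x => Real.exp (F x)), sq]
  have h := integral_sub_le_klDiv h1 h3 hKL
  rw [h2, h4, real_prod_univ] at h
  exact h

lemma klQuad_withDensity_exp {β : Measure X} [IsFiniteMeasure β] {F : X → ℝ} (hF : Measurable F)
    {α : Measure X} [IsFiniteMeasure α]
    (hα : α = β.withDensity (fun x => ENNReal.ofReal (Real.exp (F x)))) (hFα : Integrable F α) :
    klQuad α β ≠ ∞ ∧ (klQuad α β).toReal
      = 2 * α.real Set.univ * ∫ x, F x ∂α - α.real Set.univ ^ 2 + β.real Set.univ ^ 2 := by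
  obtain ⟨h1, h2⟩ := integral_fst_add_snd hFα
  have hm : Measurable fun x => ENNReal.ofReal (Real.exp (F x)) := by fun_prop
  have hprod : α.prod α = (β.prod β).withDensity
      (fun z : X × X => ENNReal.ofReal (Real.exp (F z.1 + F z.2))) := by
    have : SFinite (β.withDensity fun x => ENNReal.ofReal (Real.exp (F x))) := by
      rw [← hα]; infer_instance
    conv_lhs => rw [hα]
    rw [prod_withDensity hm hm]
    congr 1
    funext z
    rw [Real.exp_add, ENNReal.ofReal_mul (Real.exp_pos _).le]
  obtain ⟨h3, h4⟩ := klDiv_withDensity_exp (Q := β.prod β) (P := α.prod α)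
    (f := fun z : X × X => F z.1 + F z.2) (by fun_prop) hprod h1
  refine ⟨h3, ?_⟩
  rw [klQuad, h4, h2, real_prod_univ, real_prod_univ]

/-- Finite divergence transfers exponential integrability of `N` under the reference measure to
integrability of `N`. The variational inequality is applied to the truncations `min N k`. -/
lemma integrable_of_klQuad_ne_top {α β : Measure X} [IsFiniteMeasure α] [IsFiniteMeasure β]
    {N : X → ℝ} (hN : Measurable N) (hN0 : ∀ x, 0 ≤ N x)
    (hexp : Integrable (fun x => Real.exp (N x)) β) (hKL : klQuad α β ≠ ∞) :
    Integrable N α := by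
  rcases eq_zero_or_neZero α with rfl | hα
  · exact integrable_zero_measure
  have hp : 0 < α.real Set.univ := measureReal_univ_pos
  set B : ℝ := ((klQuad α β).toReal + (∫ x, Real.exp (N x) ∂β) ^ 2) / (2 * α.real Set.univ) with hB
  have hmin : ∀ k : ℕ, Measurable fun x => min (N x) (k : ℝ) := fun k => by fun_prop
  have hint : ∀ k : ℕ, Integrable (fun x => min (N x) (k : ℝ)) α := fun k =>
    Integrable.of_bound (hmin k).aestronglyMeasurable (k : ℝ) (ae_of_all _ fun x => by
      rw [Real.norm_of_nonneg (le_min (hN0 x) k.cast_nonneg)]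
      exact min_le_right _ _)
  have hexpk : ∀ k : ℕ, Integrable (fun x => Real.exp (min (N x) (k : ℝ))) β := fun k =>
    hexp.mono' (by fun_prop) (ae_of_all _ fun x => by
      rw [Real.norm_of_nonneg (Real.exp_pos _).le]
      exact Real.exp_le_exp.2 (min_le_left _ _))
  have hbound : ∀ k : ℕ, ∫ x, min (N x) (k : ℝ) ∂α ≤ B := by
    intro k
    have h := le_klQuad (hint k) (hexpk k) hKL
    have h1 : ∫ x, Real.exp (min (N x) (k : ℝ)) ∂β ≤ ∫ x, Real.exp (N x) ∂β :=
      integral_mono (hexpk k) hexp fun x => Real.exp_le_exp.2 (min_le_left _ _)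
    have h0 : 0 ≤ ∫ x, Real.exp (min (N x) (k : ℝ)) ∂β :=
      integral_nonneg fun x => (Real.exp_pos _).le
    have h2 := pow_le_pow_left₀ h0 h1 2
    rw [hB, le_div_iff₀ (by positivity)]
    nlinarith [sq_nonneg (β.real Set.univ)]
  refine ⟨hN.aestronglyMeasurable, ?_⟩
  rw [hasFiniteIntegral_iff_ofReal (ae_of_all _ hN0)]
  have hlim : ∀ x, ENNReal.ofReal (N x)
      ≤ Filter.liminf (fun k : ℕ => ENNReal.ofReal (min (N x) (k : ℝ))) Filter.atTop := by
    intro x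
    refine Filter.le_liminf_of_le (by isBoundedDefault) ?_
    obtain ⟨k, hk⟩ := exists_nat_ge (N x)
    filter_upwards [Filter.eventually_ge_atTop k] with l hl
    have : N x ≤ (l : ℝ) := hk.trans (by exact_mod_cast hl)
    rw [min_eq_left this]
  calc ∫⁻ x, ENNReal.ofReal (N x) ∂α
      ≤ ∫⁻ x, Filter.liminf (fun k : ℕ => ENNReal.ofReal (min (N x) (k : ℝ))) Filter.atTop ∂α :=
        lintegral_mono hlim
    _ ≤ Filter.liminf (fun k : ℕ => ∫⁻ x, ENNReal.ofReal (min (N x) (k : ℝ)) ∂α) Filter.atTop :=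
        lintegral_liminf_le fun k => (hmin k).ennreal_ofReal
    _ ≤ ENNReal.ofReal B := by
        refine Filter.liminf_le_of_le (by isBoundedDefault) fun b hb => ?_
        obtain ⟨k, hk⟩ := hb.exists
        refine hk.trans ?_
        rw [← ofReal_integral_eq_lintegral_ofReal (hint k)
          (ae_of_all _ fun x => le_min (hN0 x) k.cast_nonneg)]
        exact ENNReal.ofReal_le_ofReal (hbound k)
    _ < ∞ := ENNReal.ofReal_lt_top

lemma klQuad_map_le {Y : Type*} [MeasurableSpace Y] {α β : Measure X} [IsFiniteMeasure α]
    [IsFiniteMeasure β] {g : X → Y} (hg : Measurable g) :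
    klQuad (α.map g) (β.map g) ≤ klQuad α β := by
  rw [klQuad, klQuad, Measure.map_prod_map _ _ hg hg, Measure.map_prod_map _ _ hg hg]
  exact klDiv_map_le _ _ (hg.prodMap hg)

lemma klQuad_map_equiv {Y : Type*} [MeasurableSpace Y] {α β : Measure X} [IsFiniteMeasure α]
    [IsFiniteMeasure β] (e : X ≃ᵐ Y) : klQuad (α.map e) (β.map e) = klQuad α β := by
  refine le_antisymm (klQuad_map_le e.measurable) ?_
  have h := klQuad_map_le (α := α.map e) (β := β.map e) e.symm.measurable
  rwa [MeasurableEquiv.map_symm_map, MeasurableEquiv.map_symm_map] at h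

end klDiv

/-! ### Densities of Gaussian measures -/

section Gaussian

variable {ι : Type*} [Fintype ι]

/-- The quadratic form `∑ᵢⱼ Qᵢⱼ zᵢ zⱼ`. -/
def quadForm (Q : Matrix ι ι ℝ) (z : EuclideanSpace ℝ ι) : ℝ :=
  ∑ i, ∑ j, Q i j * (z i * z j)

@[fun_prop]
lemma measurable_quadForm (Q : Matrix ι ι ℝ) : Measurable (quadForm Q) := by
  unfold quadForm; fun_prop

lemma quadForm_sub (Q R : Matrix ι ι ℝ) (z : EuclideanSpace ℝ ι) :
    quadForm (Q - R) z = quadForm Q z - quadForm R z := by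
  simp [quadForm, sub_mul, Finset.sum_sub_distrib]

lemma quadForm_eq_dotProduct (Q : Matrix ι ι ℝ) (z : EuclideanSpace ℝ ι) :
    quadForm Q z = dotProduct z.ofLp (Q.mulVec z.ofLp) := by
  simp only [quadForm, dotProduct, Matrix.mulVec, Finset.mul_sum]
  exact Finset.sum_congr rfl fun i _ => Finset.sum_congr rfl fun j _ => by ring

lemma map_withDensity_equiv {X Y : Type*} [MeasurableSpace X] [MeasurableSpace Y] (e : X ≃ᵐ Y)
    (μ : Measure X) (f : X → ℝ≥0∞) :
    (μ.withDensity f).map e = (μ.map e).withDensity (f ∘ e.symm) := by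
  ext s hs
  rw [e.map_apply, withDensity_apply _ (e.measurable hs), withDensity_apply _ hs,
    e.restrict_map, lintegral_map_equiv]
  simp

/-- The normalizing constant of the standard Gaussian density. -/
def gaussConst (ι : Type*) [Fintype ι] : ℝ := ((2 * Real.pi) ^ ((Fintype.card ι : ℝ) / 2))⁻¹

lemma gaussConst_pos : 0 < gaussConst ι := by
  unfold gaussConst; positivity

lemma integrable_exp_neg_norm_sq :
    Integrable (fun z : EuclideanSpace ℝ ι => Real.exp (-(1 / 2) * ‖z‖ ^ 2)) := by
  have h := GaussianFourier.integrable_cexp_neg_mul_sq_norm_add (V := EuclideanSpace ℝ ι)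
    (b := 1 / 2) (by norm_num) 0 0
  refine h.norm.congr (ae_of_all _ fun z => ?_)
  simp only [Complex.norm_exp]
  congr 1
  simp [← Complex.ofReal_pow]

/-- The Lebesgue density of the standard Gaussian, identified through characteristic functions. -/
lemma stdGaussian_eq_withDensity :
    stdGaussian (EuclideanSpace ℝ ι) = volume.withDensity
      (fun z => ENNReal.ofReal (gaussConst ι * Real.exp (-(1 / 2) * ‖z‖ ^ 2))) := by
  have hint : Integrable (fun z : EuclideanSpace ℝ ι =>
      gaussConst ι * Real.exp (-(1 / 2) * ‖z‖ ^ 2)) := integrable_exp_neg_norm_sq.const_mul _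
  have hfin := isFiniteMeasure_withDensity_ofReal hint.2
  refine Measure.ext_of_charFun (E := EuclideanSpace ℝ ι) (funext fun t => ?_)
  rw [charFun_stdGaussian, charFun_apply,
    integral_withDensity_eq_integral_toReal_smul (by fun_prop) (ae_of_all _ fun _ => by simp)]
  have h := GaussianFourier.integral_cexp_neg_mul_sq_norm_add_of_euclideanSpace (ι := ι)
    (b := 1 / 2) (by norm_num) Complex.I t
  have h1 : ∀ z : EuclideanSpace ℝ ι,
      (ENNReal.ofReal (gaussConst ι * Real.exp (-(1 / 2) * ‖z‖ ^ 2))).toReal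
        • Complex.exp (inner ℝ z t * Complex.I)
      = gaussConst ι * Complex.exp (-(1 / 2) * ‖z‖ ^ 2 + Complex.I * inner ℝ t z) := by
    intro z
    rw [ENNReal.toReal_ofReal (mul_nonneg gaussConst_pos.le (Real.exp_pos _).le),
      Complex.exp_add, Complex.real_smul, real_inner_comm]
    push_cast
    ring_nf
  simp_rw [h1]
  rw [integral_const_mul, h]
  have h2 : ((Real.pi : ℂ) / (1 / 2)) ^ ((Fintype.card ι : ℂ) / 2)
      = (((2 * Real.pi) ^ ((Fintype.card ι : ℝ) / 2) : ℝ) : ℂ) := by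
    rw [Complex.ofReal_cpow (by positivity)]
    push_cast
    congr 1
    ring
  rw [h2, ← mul_assoc, ← Complex.ofReal_mul, gaussConst, inv_mul_cancel₀ (by positivity)]
  simp only [Complex.I_sq, Complex.ofReal_one, one_mul]
  congr 1
  ring

variable [DecidableEq ι]

open scoped MatrixOrder in
/-- The Lebesgue density of a nondegenerate centred Gaussian measure. -/
lemma multivariateGaussian_eq_withDensity {T : Matrix ι ι ℝ} (hT : T.PosDef) :
    multivariateGaussian 0 T = volume.withDensity (fun z =>
      ENNReal.ofReal (gaussConst ι / Real.sqrt T.det * Real.exp (-(1 / 2) * quadForm T⁻¹ z))) := by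
  set A := CFC.sqrt T with hA
  have hAA : A * A = T := CFC.sqrt_mul_sqrt_self _ hT.posSemidef.nonneg
  have hApsd : A.PosSemidef := Matrix.nonneg_iff_posSemidef.1 (CFC.sqrt_nonneg T)
  have hdetsq : A.det * A.det = T.det := by rw [← Matrix.det_mul, hAA]
  have hdet : Real.sqrt T.det = A.det := by
    rw [← hdetsq, Real.sqrt_mul_self hApsd.det_nonneg]
  have hTdet := hT.det_pos
  have hdetpos : 0 < A.det := by rw [← hdet]; exact Real.sqrt_pos.2 hTdet
  have hunit : IsUnit A.det := hdetpos.ne'.isUnit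
  have hAt : A.transpose = A := by
    have := hApsd.isHermitian
    rwa [Matrix.IsHermitian, Matrix.conjTranspose_eq_transpose_of_trivial] at this
  -- the linear equivalence `z ↦ A z`
  let e : EuclideanSpace ℝ ι ≃ᵐ EuclideanSpace ℝ ι :=
    { toFun := Matrix.toEuclideanCLM (𝕜 := ℝ) A
      invFun := Matrix.toEuclideanCLM (𝕜 := ℝ) A⁻¹
      left_inv := fun z => by
        rw [← ContinuousLinearMap.comp_apply, ← ContinuousLinearMap.mul_def, ← map_mul,
          Matrix.nonsing_inv_mul _ hunit, map_one]; rfl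
      right_inv := fun z => by
        rw [← ContinuousLinearMap.comp_apply, ← ContinuousLinearMap.mul_def, ← map_mul,
          Matrix.mul_nonsing_inv _ hunit, map_one]; rfl
      measurable_toFun := (Matrix.toEuclideanCLM (𝕜 := ℝ) A).continuous.measurable
      measurable_invFun := (Matrix.toEuclideanCLM (𝕜 := ℝ) A⁻¹).continuous.measurable }
  have he : multivariateGaussian 0 T = (stdGaussian (EuclideanSpace ℝ ι)).map e := by
    rw [multivariateGaussian]
    congr 1
    funext z
    rw [zero_add]; rfl
  have hvol : (volume : Measure (EuclideanSpace ℝ ι)).map e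
      = ENNReal.ofReal (A.det)⁻¹ • volume := by
    have hlin : (e : EuclideanSpace ℝ ι → EuclideanSpace ℝ ι) = Matrix.toLpLin 2 2 A := rfl
    have hd : LinearMap.det (Matrix.toLpLin 2 2 A : EuclideanSpace ℝ ι →ₗ[ℝ] EuclideanSpace ℝ ι)
        = A.det := by rw [LinearMap.det_toLpLin]
    rw [hlin, Measure.map_linearMap_addHaar_eq_smul_addHaar _ (by rw [hd]; exact hdetpos.ne'), hd,
      abs_of_pos (inv_pos.2 hdetpos)]
  have hnorm : ∀ z, ‖e.symm z‖ ^ 2 = quadForm T⁻¹ z := by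
    intro z
    have h1 : e.symm z = Matrix.toEuclideanCLM (𝕜 := ℝ) A⁻¹ z := rfl
    have h2 : (A⁻¹).transpose = A⁻¹ := by rw [Matrix.transpose_nonsing_inv, hAt]
    rw [EuclideanSpace.real_norm_sq_eq, quadForm_eq_dotProduct, h1, ← hAA, Matrix.mul_inv_rev,
      ← Matrix.mulVec_mulVec, Matrix.dotProduct_mulVec, ← Matrix.mulVec_transpose, h2,
      Matrix.ofLp_toEuclideanCLM]
    simp [dotProduct, sq]
  rw [he, stdGaussian_eq_withDensity, map_withDensity_equiv, hvol, withDensity_smul_measure,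
    ← withDensity_smul _ (by fun_prop)]
  congr 1
  funext z
  simp only [Pi.smul_apply, Function.comp_apply, smul_eq_mul, hnorm]
  rw [← ENNReal.ofReal_mul (by positivity), hdet]
  congr 1
  ring

/-- The logarithm of the density of `N(0, T)` with respect to `N(0, S)`. -/
def gaussLlr (S T : Matrix ι ι ℝ) (z : EuclideanSpace ℝ ι) : ℝ :=
  1 / 2 * (Real.log S.det - Real.log T.det) + 1 / 2 * quadForm (S⁻¹ - T⁻¹) z

@[fun_prop]
lemma measurable_gaussLlr (S T : Matrix ι ι ℝ) : Measurable (gaussLlr S T) := by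
  unfold gaussLlr; fun_prop

lemma multivariateGaussian_eq_withDensity_exp {S T : Matrix ι ι ℝ} (hS : S.PosDef)
    (hT : T.PosDef) :
    multivariateGaussian 0 T = (multivariateGaussian 0 S).withDensity
      (fun z => ENNReal.ofReal (Real.exp (gaussLlr S T z))) := by
  rw [multivariateGaussian_eq_withDensity hS, multivariateGaussian_eq_withDensity hT,
    ← withDensity_mul _ (by fun_prop) (by fun_prop)]
  congr 1
  funext z
  have hSd := hS.det_pos
  have hTd := hT.det_pos
  have hexp : ∀ {D : ℝ}, 0 < D → Real.exp (1 / 2 * Real.log D) = Real.sqrt D := by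
    intro D hD
    rw [Real.sqrt_eq_rpow, Real.rpow_def_of_pos hD, mul_comm]
  simp only [Pi.mul_apply]
  rw [← ENNReal.ofReal_mul (mul_nonneg (div_nonneg gaussConst_pos.le (Real.sqrt_nonneg _))
    (Real.exp_pos _).le)]
  congr 1
  have h1 : Real.exp (gaussLlr S T z) = Real.sqrt S.det / Real.sqrt T.det
      * (Real.exp (1 / 2 * quadForm S⁻¹ z) * Real.exp (-(1 / 2) * quadForm T⁻¹ z)) := by
    rw [← hexp hSd, ← hexp hTd, ← Real.exp_sub, ← Real.exp_add, ← Real.exp_add, gaussLlr,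
      quadForm_sub]
    congr 1; ring
  have h2 : Real.exp (-(1 / 2) * quadForm S⁻¹ z) * Real.exp (1 / 2 * quadForm S⁻¹ z) = 1 := by
    rw [← Real.exp_add, ← Real.exp_zero]; congr 1; ring
  have h3 : Real.sqrt S.det ≠ 0 := (Real.sqrt_pos.2 hSd).ne'
  rw [h1]
  calc gaussConst ι / √T.det * Real.exp (-(1 / 2) * quadForm T⁻¹ z)
      = gaussConst ι / √T.det * Real.exp (-(1 / 2) * quadForm T⁻¹ z) * (√S.det / √S.det)
        * (Real.exp (-(1 / 2) * quadForm S⁻¹ z) * Real.exp (1 / 2 * quadForm S⁻¹ z)) := by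
        rw [h2, div_self h3, mul_one, mul_one]
    _ = _ := by ring

/-- The density of `M · N(0, T)` with respect to `b · N(0, S)`. -/
lemma smul_multivariateGaussian_eq_withDensity {S T : Matrix ι ι ℝ} (hS : S.PosDef)
    (hT : T.PosDef) {M b : ℝ} (hM : 0 < M) (hb : 0 < b) :
    ENNReal.ofReal M • multivariateGaussian 0 T
      = (ENNReal.ofReal b • multivariateGaussian 0 S).withDensity
        (fun z => ENNReal.ofReal (Real.exp (Real.log (M / b) + gaussLlr S T z))) := by
  rw [withDensity_smul_measure, multivariateGaussian_eq_withDensity_exp hS hT,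
    ← withDensity_smul _ (by fun_prop), ← withDensity_smul _ (by fun_prop)]
  congr 1
  funext z
  simp only [Pi.smul_apply, smul_eq_mul]
  rw [← ENNReal.ofReal_mul hM.le, ← ENNReal.ofReal_mul hb.le, Real.exp_add,
    Real.exp_log (by positivity)]
  congr 1
  field_simp

end Gaussian

/-! ### The divergence of a measure from a Gaussian measure -/

section GaussianDivergence

variable {ι : Type*} [Fintype ι]

lemma abs_coord_mul_le (z : EuclideanSpace ℝ ι) (i j : ι) : |z i * z j| ≤ ‖z‖ ^ 2 := by
  have h : ∀ k, |z k| ≤ ‖z‖ := fun k => by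
    simpa using PiLp.norm_apply_le z k
  rw [abs_mul, sq]
  exact mul_le_mul (h i) (h j) (abs_nonneg _) (norm_nonneg _)

/-- The matrix of (unnormalized, uncentred) second moments. -/
def secondMoment (α : Measure (EuclideanSpace ℝ ι)) : Matrix ι ι ℝ :=
  Matrix.of fun i j => ∫ z, z i * z j ∂α

lemma integral_quadForm {α : Measure (EuclideanSpace ℝ ι)}
    (hα : ∀ i j, Integrable (fun z => z i * z j) α) (Q : Matrix ι ι ℝ) :
    Integrable (quadForm Q) α ∧ ∫ z, quadForm Q z ∂α = ∑ i, ∑ j, Q i j * secondMoment α i j := by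
  have h1 : ∀ i j, Integrable (fun z : EuclideanSpace ℝ ι => Q i j * (z i * z j)) α :=
    fun i j => (hα i j).const_mul _
  have h2 : ∀ i, Integrable (fun z : EuclideanSpace ℝ ι => ∑ j, Q i j * (z i * z j)) α :=
    fun i => integrable_finsetSum _ fun j _ => h1 i j
  refine ⟨integrable_finsetSum _ fun i _ => h2 i, ?_⟩
  simp only [quadForm]
  rw [integral_finsetSum _ fun i _ => h2 i]
  refine Finset.sum_congr rfl fun i _ => ?_
  rw [integral_finsetSum _ fun j _ => h1 i j]
  exact Finset.sum_congr rfl fun j _ => by rw [integral_const_mul]; rfl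

lemma posSemidef_secondMoment {α : Measure (EuclideanSpace ℝ ι)}
    (hα : ∀ i j, Integrable (fun z => z i * z j) α) : (secondMoment α).PosSemidef := by
  refine Matrix.PosSemidef.of_dotProduct_mulVec_nonneg ?_ fun v => ?_
  · ext i j
    simp [secondMoment, mul_comm]
  · have h := (integral_quadForm hα (Matrix.of fun i j => v i * v j)).2
    have h2 : dotProduct (star v) ((secondMoment α).mulVec v)
        = ∫ z, quadForm (Matrix.of fun i j => v i * v j) z ∂α := by
      rw [h]
      simp only [dotProduct, Matrix.mulVec, Finset.mul_sum]
      exact Finset.sum_congr rfl fun i _ => Finset.sum_congr rfl fun j _ => by simp; ring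
    rw [h2]
    refine integral_nonneg fun z => ?_
    have h3 : quadForm (Matrix.of fun i j => v i * v j) z = (∑ i, v i * z i) ^ 2 := by
      rw [sq, Finset.sum_mul_sum]
      exact Finset.sum_congr rfl fun i _ => Finset.sum_congr rfl fun j _ => by simp; ring
    rw [h3]
    exact sq_nonneg _

lemma sum_mul_eq_trace (A : Matrix ι ι ℝ) {T : Matrix ι ι ℝ} (hT : T.IsHermitian) :
    ∑ i, ∑ j, A i j * T i j = (A * T).trace := by
  simp only [Matrix.trace, Matrix.diag_apply, Matrix.mul_apply]
  refine Finset.sum_congr rfl fun i _ => Finset.sum_congr rfl fun j _ => ?_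
  have := hT.apply i j
  rw [star_trivial] at this
  rw [this]

variable [DecidableEq ι]

instance isFiniteMeasure_smul_gaussian {M : ℝ} {T : Matrix ι ι ℝ} :
    IsFiniteMeasure (ENNReal.ofReal M • multivariateGaussian 0 T) :=
  Measure.smul_finite _ ENNReal.ofReal_ne_top

lemma real_univ_smul_gaussian {M : ℝ} (hM : 0 ≤ M) {T : Matrix ι ι ℝ} :
    (ENNReal.ofReal M • multivariateGaussian 0 T).real Set.univ = M := by
  rw [measureReal_def, Measure.smul_apply, measure_univ, smul_eq_mul, mul_one,
    ENNReal.toReal_ofReal hM]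

lemma integrable_coord_mul_of_klQuad {α : Measure (EuclideanSpace ℝ ι)} [IsFiniteMeasure α]
    {b : ℝ} {S : Matrix ι ι ℝ}
    (hKL : klQuad α (ENNReal.ofReal b • multivariateGaussian 0 S) ≠ ∞) (i j : ι) :
    Integrable (fun z => z i * z j) α := by
  obtain ⟨C, hC, hCint⟩ := IsGaussian.exists_integrable_exp_sq (multivariateGaussian 0 S)
  have h := integrable_of_klQuad_ne_top (N := fun z => C * ‖z‖ ^ 2) (by fun_prop)
    (fun z => by positivity) (hCint.smul_measure ENNReal.ofReal_ne_top) hKL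
  have h2 : Integrable (fun z : EuclideanSpace ℝ ι => ‖z‖ ^ 2) α := by
    refine (h.const_mul C⁻¹).congr (ae_of_all _ fun z => ?_)
    simp only; rw [inv_mul_cancel_left₀ hC.ne']
  exact h2.mono' (by fun_prop) (ae_of_all _ fun z => abs_coord_mul_le z i j)

lemma integrable_coord_mul_gaussian (T : Matrix ι ι ℝ) (i j : ι) :
    Integrable (fun z => z i * z j) (multivariateGaussian 0 T) := by
  have h : Integrable (fun z : EuclideanSpace ℝ ι => ‖z‖ ^ 2) (multivariateGaussian 0 T) :=
    (memLp_two_iff_integrable_sq_norm (by fun_prop)).1 IsGaussian.memLp_two_id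
  exact h.mono' (by fun_prop) (ae_of_all _ fun z => abs_coord_mul_le z i j)

lemma secondMoment_smul_gaussian {M : ℝ} (hM : 0 ≤ M) {T : Matrix ι ι ℝ} (hT : T.PosSemidef) :
    secondMoment (ENNReal.ofReal M • multivariateGaussian 0 T) = M • T := by
  ext i j
  have hmean : ∀ k, ∫ z, z k ∂(multivariateGaussian 0 T) = 0 := by
    intro k
    have h1 := ContinuousLinearMap.integral_comp_id_comm (μ := multivariateGaussian 0 T)
      IsGaussian.integrable_id (EuclideanSpace.proj k : EuclideanSpace ℝ ι →L[ℝ] ℝ)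
    simpa using h1
  have hmem : ∀ k, MemLp (fun z : EuclideanSpace ℝ ι => z k) 2 (multivariateGaussian 0 T) :=
    fun k => (EuclideanSpace.proj k : EuclideanSpace ℝ ι →L[ℝ] ℝ).comp_memLp'
      IsGaussian.memLp_two_id
  have h := covariance_eval_multivariateGaussian (μ := 0) hT i j
  rw [covariance_eq_sub (hmem i) (hmem j), hmean, hmean] at h
  simp only [mul_zero, sub_zero, Pi.mul_apply] at h
  have hdef : ∀ α : Measure (EuclideanSpace ℝ ι), secondMoment α i j = ∫ z, z i * z j ∂α :=
    fun _ => rfl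
  rw [hdef, integral_smul_measure, ENNReal.toReal_ofReal hM, h]
  rfl

/-- `2 KL(N(0, T) ‖ N(0, diag l))`. -/
def gaussKL (l : ι → ℝ) (T : Matrix ι ι ℝ) : ℝ :=
  ∑ i, (T i i / l i - 1 + Real.log (l i)) - Real.log T.det

lemma sum_inv_diagonal {l : ι → ℝ} (hl : ∀ i, 0 < l i) (A : Matrix ι ι ℝ) :
    ∑ i, ∑ j, (Matrix.diagonal l)⁻¹ i j * A i j = ∑ i, A i i / l i := by
  have h : (Matrix.diagonal l)⁻¹ = Matrix.diagonal fun i => (l i)⁻¹ := by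
    refine Matrix.inv_eq_left_inv ?_
    rw [Matrix.diagonal_mul_diagonal, ← Matrix.diagonal_one]
    congr 1; funext i; exact inv_mul_cancel₀ (hl i).ne'
  rw [h]
  refine Finset.sum_congr rfl fun i _ => ?_
  rw [Finset.sum_eq_single i]
  · rw [Matrix.diagonal_apply_eq, div_eq_inv_mul]
  · intro j _ hj
    rw [Matrix.diagonal_apply_ne' _ hj, zero_mul]
  · simp

lemma log_det_diagonal {l : ι → ℝ} (hl : ∀ i, 0 < l i) :
    Real.log (Matrix.diagonal l).det = ∑ i, Real.log (l i) := by
  rw [Matrix.det_diagonal, Real.log_prod fun i _ => (hl i).ne']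

lemma sum_inv_mul_self {T : Matrix ι ι ℝ} (hT : T.PosDef) :
    ∑ i, ∑ j, T⁻¹ i j * T i j = Fintype.card ι := by
  rw [sum_mul_eq_trace _ hT.isHermitian, Matrix.nonsing_inv_mul _ hT.det_pos.ne'.isUnit,
    Matrix.trace_one]

lemma klScalar_sq (p b : ℝ) :
    klScalar (p ^ 2) (b ^ 2) = p ^ 2 * (2 * Real.log (p / b)) - p ^ 2 + b ^ 2 := by
  rw [klScalar, ← div_pow, Real.log_pow]; push_cast; ring

lemma integral_log_add_gaussLlr {α : Measure (EuclideanSpace ℝ ι)} [IsFiniteMeasure α]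
    (hα : ∀ i j, Integrable (fun z => z i * z j) α) {l : ι → ℝ} (hl : ∀ i, 0 < l i)
    (T : Matrix ι ι ℝ) (c : ℝ) :
    Integrable (fun z => c + gaussLlr (Matrix.diagonal l) T z) α ∧
    ∫ z, (c + gaussLlr (Matrix.diagonal l) T z) ∂α
      = α.real Set.univ * c
        + 1 / 2 * (α.real Set.univ * (∑ i, Real.log (l i) - Real.log T.det)
          + (∑ i, secondMoment α i i / l i - ∑ i, ∑ j, T⁻¹ i j * secondMoment α i j)) := by
  obtain ⟨h1, h2⟩ := integral_quadForm hα ((Matrix.diagonal l)⁻¹ - T⁻¹)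
  have h3 : Integrable (gaussLlr (Matrix.diagonal l) T) α :=
    (integrable_const _).add (h1.const_mul _)
  refine ⟨(integrable_const c).add h3, ?_⟩
  rw [integral_add (integrable_const c) h3]
  simp only [gaussLlr]
  rw [integral_add (integrable_const _) (h1.const_mul _), integral_const_mul, integral_const_mul, h2]
  simp only [Matrix.sub_apply, sub_mul, Finset.sum_sub_distrib, sum_inv_diagonal hl,
    log_det_diagonal hl, integral_const, smul_eq_mul]
  ring

/-- The Gaussian measure with the second moments of `α`, regularized by `δ`, bounds the divergence
of `α` from below. -/
lemma gaussKL_le_klQuad {α : Measure (EuclideanSpace ℝ ι)} [IsFiniteMeasure α]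
    {b p δ : ℝ} (hb : 0 < b) (hp : 0 < p) (hαp : α.real Set.univ = p) (hδ : 0 < δ)
    {l : ι → ℝ} (hl : ∀ i, 0 < l i)
    (hKL : klQuad α (ENNReal.ofReal b • multivariateGaussian 0 (Matrix.diagonal l)) ≠ ∞) :
    p ^ 2 * (gaussKL l (p⁻¹ • secondMoment α + δ • 1) - δ * ∑ i, (l i)⁻¹)
        + klScalar (p ^ 2) (b ^ 2)
      ≤ (klQuad α (ENNReal.ofReal b • multivariateGaussian 0 (Matrix.diagonal l))).toReal := by
  have hα := integrable_coord_mul_of_klQuad hKL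
  have hpsd := posSemidef_secondMoment hα
  set A := secondMoment α with hA
  set T := p⁻¹ • A + δ • (1 : Matrix ι ι ℝ) with hT
  have hTpd : T.PosDef := by
    have h1 : (p⁻¹ • A).PosSemidef := hpsd.smul (inv_nonneg.2 hp.le)
    exact (Matrix.PosDef.one.smul hδ).posSemidef_add h1
  have hSpd : (Matrix.diagonal l).PosDef := Matrix.PosDef.diagonal hl
  have hdens := smul_multivariateGaussian_eq_withDensity hSpd hTpd hp hb
  obtain ⟨hF, hFint⟩ := integral_log_add_gaussLlr hα hl T (Real.log (p / b))
  have hexp : Integrable (fun z => Real.exp (Real.log (p / b) + gaussLlr (Matrix.diagonal l) T z))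
      (ENNReal.ofReal b • multivariateGaussian 0 (Matrix.diagonal l)) ∧
      ∫ z, Real.exp (Real.log (p / b) + gaussLlr (Matrix.diagonal l) T z)
        ∂(ENNReal.ofReal b • multivariateGaussian 0 (Matrix.diagonal l)) = p := by
    have hL : ∫⁻ z, ENNReal.ofReal
        (Real.exp (Real.log (p / b) + gaussLlr (Matrix.diagonal l) T z))
        ∂(ENNReal.ofReal b • multivariateGaussian 0 (Matrix.diagonal l)) = ENNReal.ofReal p := by
      rw [← setLIntegral_univ, ← withDensity_apply _ MeasurableSet.univ, ← hdens,
        Measure.smul_apply, measure_univ, smul_eq_mul, mul_one]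
    constructor
    · rw [← lintegral_ofReal_ne_top_iff_integrable (by fun_prop)
        (ae_of_all _ fun z => (Real.exp_pos _).le), hL]
      exact ENNReal.ofReal_ne_top
    · rw [integral_eq_lintegral_of_nonneg_ae (ae_of_all _ fun z => (Real.exp_pos _).le)
        (by fun_prop), hL, ENNReal.toReal_ofReal hp.le]
  have h := le_klQuad hF hexp.1 hKL
  rw [hFint, hexp.2, hαp, real_univ_smul_gaussian hb.le] at h
  refine le_trans ?_ h
  rw [klScalar_sq]
  -- `∑ᵢⱼ T⁻¹ᵢⱼ Aᵢⱼ = p (card ι - δ tr T⁻¹) ≤ p card ι`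
  have hAT : ∀ i j, A i j = p * (T i j - δ * (1 : Matrix ι ι ℝ) i j) := by
    intro i j
    have hTij : T i j = p⁻¹ * A i j + δ * (1 : Matrix ι ι ℝ) i j := rfl
    rw [hTij, add_sub_cancel_right, mul_inv_cancel_left₀ hp.ne']
  have htr : 0 ≤ (T⁻¹).trace := hTpd.inv.posSemidef.trace_nonneg
  have h1 : ∑ i, ∑ j, T⁻¹ i j * A i j = p * (Fintype.card ι - δ * (T⁻¹).trace) := by
    have h2 : ∀ i j, T⁻¹ i j * A i j
        = p * (T⁻¹ i j * T i j) - p * δ * (T⁻¹ i j * (1 : Matrix ι ι ℝ) i j) := by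
      intro i j; rw [hAT]; ring
    simp_rw [h2, Finset.sum_sub_distrib, ← Finset.mul_sum]
    rw [sum_inv_mul_self hTpd, sum_mul_eq_trace _ Matrix.isHermitian_one, Matrix.mul_one]
    ring
  have h3 : ∑ i, A i i / l i = p * (∑ i, T i i / l i - δ * ∑ i, (l i)⁻¹) := by
    rw [Finset.mul_sum, ← Finset.sum_sub_distrib, Finset.mul_sum]
    refine Finset.sum_congr rfl fun i _ => ?_
    rw [hAT, Matrix.one_apply_eq]
    ring
  have h4 : gaussKL l T = ∑ i, T i i / l i - Fintype.card ι + ∑ i, Real.log (l i)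
      - Real.log T.det := by
    simp [gaussKL, Finset.sum_add_distrib, Finset.sum_sub_distrib]
  rw [h1, h3, h4]
  have h5 : 0 ≤ p ^ 2 * (δ * (T⁻¹).trace) := by positivity
  nlinarith

lemma klQuad_gaussian {b M : ℝ} (hb : 0 < b) (hM : 0 < M)
    {l : ι → ℝ} (hl : ∀ i, 0 < l i) {T : Matrix ι ι ℝ} (hT : T.PosDef) :
    klQuad (ENNReal.ofReal M • multivariateGaussian 0 T)
        (ENNReal.ofReal b • multivariateGaussian 0 (Matrix.diagonal l)) ≠ ∞ ∧
      (klQuad (ENNReal.ofReal M • multivariateGaussian 0 T)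
        (ENNReal.ofReal b • multivariateGaussian 0 (Matrix.diagonal l))).toReal
        = M ^ 2 * gaussKL l T + klScalar (M ^ 2) (b ^ 2) := by
  have hSpd : (Matrix.diagonal l).PosDef := Matrix.PosDef.diagonal hl
  have hdens := smul_multivariateGaussian_eq_withDensity hSpd hT hM hb
  obtain ⟨hF, hFint⟩ := integral_log_add_gaussLlr
    (α := ENNReal.ofReal M • multivariateGaussian 0 T)
    (fun i j => (integrable_coord_mul_gaussian T i j).smul_measure ENNReal.ofReal_ne_top)
    hl T (Real.log (M / b))
  obtain ⟨h1, h2⟩ := klQuad_withDensity_exp (by fun_prop) hdens hF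
  refine ⟨h1, ?_⟩
  rw [h2, hFint, real_univ_smul_gaussian hb.le, real_univ_smul_gaussian hM.le, klScalar_sq,
    secondMoment_smul_gaussian hM.le hT.posSemidef]
  have h3 : ∑ i, ∑ j, T⁻¹ i j * (M • T) i j = M * Fintype.card ι := by
    rw [← sum_inv_mul_self hT, Finset.mul_sum]
    simp_rw [Finset.mul_sum]
    exact Finset.sum_congr rfl fun i _ => Finset.sum_congr rfl fun j _ => by
      rw [Matrix.smul_apply, smul_eq_mul]; ring
  have h4 : ∑ i, (M • T) i i / l i = M * ∑ i, T i i / l i := by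
    rw [Finset.mul_sum]
    exact Finset.sum_congr rfl fun i _ => by
      rw [Matrix.smul_apply, smul_eq_mul]; ring
  have h5 : gaussKL l T = ∑ i, T i i / l i - Fintype.card ι + ∑ i, Real.log (l i)
      - Real.log T.det := by
    simp [gaussKL, Finset.sum_add_distrib, Finset.sum_sub_distrib]
  rw [h3, h4, h5]
  ring

/-- Coordinate restrictions of centred Gaussian measures are Gaussian. -/
lemma map_comp_multivariateGaussian {κ : Type*} [Fintype κ] [DecidableEq κ] (f : κ → ι)
    {T : Matrix ι ι ℝ} (hT : T.PosSemidef) :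
    (multivariateGaussian 0 T).map
      (fun z : EuclideanSpace ℝ ι => (WithLp.toLp 2 fun k => z (f k) : EuclideanSpace ℝ κ))
      = multivariateGaussian 0 (T.submatrix f f) := by
  have hmeas : Measurable
      (fun z : EuclideanSpace ℝ ι => (WithLp.toLp 2 fun k => z (f k) : EuclideanSpace ℝ κ)) := by
    fun_prop
  have := Measure.isProbabilityMeasure_map (μ := multivariateGaussian 0 T) hmeas.aemeasurable
  refine Measure.ext_of_charFun (E := EuclideanSpace ℝ κ) (funext fun t => ?_)
  set t' : EuclideanSpace ℝ ι := WithLp.toLp 2 fun i => ∑ k, if f k = i then t k else 0 with ht'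
  have hdot : ∀ v : ι → ℝ, dotProduct t'.ofLp v = dotProduct t.ofLp (fun k => v (f k)) := by
    intro v
    simp only [ht', dotProduct, Finset.sum_mul]
    rw [Finset.sum_comm]
    refine Finset.sum_congr rfl fun k _ => ?_
    simp
  have h1 : charFun ((multivariateGaussian 0 T).map
      (fun z : EuclideanSpace ℝ ι => (WithLp.toLp 2 fun k => z (f k) : EuclideanSpace ℝ κ))) t
      = charFun (multivariateGaussian 0 T) t' := by
    rw [charFun_apply, charFun_apply, integral_map hmeas.aemeasurable (by fun_prop)]
    refine integral_congr_ae (ae_of_all _ fun z => ?_)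
    have : inner ℝ (WithLp.toLp 2 fun k => z (f k) : EuclideanSpace ℝ κ) t = inner ℝ z t' := by
      simp only [EuclideanSpace.inner_eq_star_dotProduct, star_trivial]
      exact (hdot z.ofLp).symm
    simp only [this]
  rw [h1, charFun_multivariateGaussian hT, charFun_multivariateGaussian (hT.submatrix f)]
  have h2 : dotProduct t'.ofLp (T.mulVec t'.ofLp)
      = dotProduct t.ofLp ((T.submatrix f f).mulVec t.ofLp) := by
    rw [hdot]
    congr 1
    funext k
    simp only [Matrix.mulVec]
    rw [dotProduct_comm, hdot, dotProduct_comm]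
    rfl
  rw [h2]
  simp

end GaussianDivergence

/-! ### The product space -/

section Product

variable {m n : ℕ}

/-- The identification of `ℝ^(m+n)` with `ℝ^m × ℝ^n`. -/
def splitEquiv (m n : ℕ) : EuclideanSpace ℝ (Fin m ⊕ Fin n) ≃ᵐ E m × E n where
  toFun z := (WithLp.toLp 2 (fun i => z (Sum.inl i)), WithLp.toLp 2 (fun j => z (Sum.inr j)))
  invFun w := WithLp.toLp 2 (Sum.elim w.1 w.2)
  left_inv z := by
    ext k
    rcases k with i | j <;> rfl
  right_inv w := rfl
  measurable_toFun := by
    change Measurable fun z : EuclideanSpace ℝ (Fin m ⊕ Fin n) =>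
      ((WithLp.toLp 2 (fun i => z (Sum.inl i)) : E m),
        (WithLp.toLp 2 (fun j => z (Sum.inr j)) : E n))
    fun_prop
  measurable_invFun := by
    change Measurable fun w : E m × E n =>
      (WithLp.toLp 2 (Sum.elim w.1 w.2) : EuclideanSpace ℝ (Fin m ⊕ Fin n))
    refine (WithLp.measurable_toLp 2 _).comp (measurable_pi_iff.2 fun k => ?_)
    rcases k with i | j <;> simp only [Sum.elim_inl, Sum.elim_inr] <;> fun_prop

@[simp]
lemma splitEquiv_fst (z : EuclideanSpace ℝ (Fin m ⊕ Fin n)) (i : Fin m) :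
    (splitEquiv m n z).1 i = z (Sum.inl i) := rfl

@[simp]
lemma splitEquiv_snd (z : EuclideanSpace ℝ (Fin m ⊕ Fin n)) (j : Fin n) :
    (splitEquiv m n z).2 j = z (Sum.inr j) := rfl

/-- The measure on `ℝ^m × ℝ^n` corresponding to a measure on `ℝ^(m+n)`. -/
def splitMeasure (ρ : Measure (EuclideanSpace ℝ (Fin m ⊕ Fin n))) : Measure (E m × E n) :=
  ρ.map (splitEquiv m n)

instance {ρ : Measure (EuclideanSpace ℝ (Fin m ⊕ Fin n))} [IsFiniteMeasure ρ] :
    IsFiniteMeasure (splitMeasure ρ) := by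
  unfold splitMeasure; infer_instance

lemma scaledGaussianProd_eq (M : ℝ) (S : Matrix (Fin m ⊕ Fin n) (Fin m ⊕ Fin n) ℝ) :
    scaledGaussianProd M S = splitMeasure (ENNReal.ofReal M • multivariateGaussian 0 S) := by
  rw [scaledGaussianProd, splitMeasure, Measure.map_smul]
  rfl

/-- The law of the first block of coordinates. -/
def leftMarginal (ρ : Measure (EuclideanSpace ℝ (Fin m ⊕ Fin n))) : Measure (E m) :=
  ρ.map fun z => WithLp.toLp 2 fun i => z (Sum.inl i)

/-- The law of the second block of coordinates. -/
def rightMarginal (ρ : Measure (EuclideanSpace ℝ (Fin m ⊕ Fin n))) : Measure (E n) :=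
  ρ.map fun z => WithLp.toLp 2 fun j => z (Sum.inr j)

instance {ρ : Measure (EuclideanSpace ℝ (Fin m ⊕ Fin n))} [IsFiniteMeasure ρ] :
    IsFiniteMeasure (leftMarginal ρ) := by
  unfold leftMarginal; infer_instance

instance {ρ : Measure (EuclideanSpace ℝ (Fin m ⊕ Fin n))} [IsFiniteMeasure ρ] :
    IsFiniteMeasure (rightMarginal ρ) := by
  unfold rightMarginal; infer_instance

lemma fst_splitMeasure (ρ : Measure (EuclideanSpace ℝ (Fin m ⊕ Fin n))) :
    (splitMeasure ρ).fst = leftMarginal ρ := by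
  rw [splitMeasure, Measure.fst, Measure.map_map measurable_fst (splitEquiv m n).measurable]
  rfl

lemma snd_splitMeasure (ρ : Measure (EuclideanSpace ℝ (Fin m ⊕ Fin n))) :
    (splitMeasure ρ).snd = rightMarginal ρ := by
  rw [splitMeasure, Measure.snd, Measure.map_map measurable_snd (splitEquiv m n).measurable]
  rfl

lemma secondMoment_leftMarginal (ρ : Measure (EuclideanSpace ℝ (Fin m ⊕ Fin n))) :
    secondMoment (leftMarginal ρ) = (secondMoment ρ).toBlocks₁₁ := by
  ext i j
  exact integral_map (by fun_prop) (by fun_prop)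

lemma secondMoment_rightMarginal (ρ : Measure (EuclideanSpace ℝ (Fin m ⊕ Fin n))) :
    secondMoment (rightMarginal ρ) = (secondMoment ρ).toBlocks₂₂ := by
  ext i j
  exact integral_map (by fun_prop) (by fun_prop)

lemma real_univ_leftMarginal (ρ : Measure (EuclideanSpace ℝ (Fin m ⊕ Fin n))) :
    (leftMarginal ρ).real Set.univ = ρ.real Set.univ := by
  rw [leftMarginal, measureReal_def, Measure.map_apply (by fun_prop) MeasurableSet.univ]
  rfl

lemma real_univ_rightMarginal (ρ : Measure (EuclideanSpace ℝ (Fin m ⊕ Fin n))) :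
    (rightMarginal ρ).real Set.univ = ρ.real Set.univ := by
  rw [rightMarginal, measureReal_def, Measure.map_apply (by fun_prop) MeasurableSet.univ]
  rfl

lemma leftMarginal_gaussian (M : ℝ) {T : Matrix (Fin m ⊕ Fin n) (Fin m ⊕ Fin n) ℝ}
    (hT : T.PosSemidef) :
    leftMarginal (ENNReal.ofReal M • multivariateGaussian 0 T)
      = ENNReal.ofReal M • multivariateGaussian 0 T.toBlocks₁₁ := by
  rw [leftMarginal, Measure.map_smul, map_comp_multivariateGaussian Sum.inl hT]
  rfl

lemma rightMarginal_gaussian (M : ℝ) {T : Matrix (Fin m ⊕ Fin n) (Fin m ⊕ Fin n) ℝ}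
    (hT : T.PosSemidef) :
    rightMarginal (ENNReal.ofReal M • multivariateGaussian 0 T)
      = ENNReal.ofReal M • multivariateGaussian 0 T.toBlocks₂₂ := by
  rw [rightMarginal, Measure.map_smul, map_comp_multivariateGaussian Sum.inr hT]
  rfl

/-- The product of two Gaussian measures with diagonal covariances. -/
lemma prod_scaledGaussian {a b : ℝ} (ha : 0 ≤ a) {lμ : Fin m → ℝ} {lν : Fin n → ℝ}
    (hlμ : ∀ i, 0 < lμ i) (hlν : ∀ j, 0 < lν j) :
    (scaledGaussian a lμ).prod (scaledGaussian b lν)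
      = splitMeasure (ENNReal.ofReal (a * b)
        • multivariateGaussian 0 (Matrix.diagonal (Sum.elim lμ lν))) := by
  have hl : ∀ k, 0 < Sum.elim lμ lν k := by
    rintro (i | j)
    · exact hlμ i
    · exact hlν j
  have hD : (Matrix.diagonal (Sum.elim lμ lν)).PosSemidef := (Matrix.PosDef.diagonal hl).posSemidef
  have hprod : (multivariateGaussian 0 (Matrix.diagonal (Sum.elim lμ lν))).map (splitEquiv m n)
      = (multivariateGaussian 0 (Matrix.diagonal lμ)).prod
        (multivariateGaussian 0 (Matrix.diagonal lν)) := by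
    have hprob := Measure.isProbabilityMeasure_map
      (μ := multivariateGaussian 0 (Matrix.diagonal (Sum.elim lμ lν)))
      (splitEquiv m n).measurable.aemeasurable
    refine charFun_eq_prod_iff.1 fun t => ?_
    have h1 : charFun (((multivariateGaussian 0 (Matrix.diagonal (Sum.elim lμ lν))).map
        (splitEquiv m n)).map (WithLp.toLp 2)) t
        = charFun (multivariateGaussian 0 (Matrix.diagonal (Sum.elim lμ lν)))
          (WithLp.toLp 2 (Sum.elim t.fst t.snd)) := by
      rw [charFun_apply, charFun_apply, integral_map (by fun_prop) (by fun_prop),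
        integral_map (splitEquiv m n).measurable.aemeasurable (by fun_prop)]
      refine integral_congr_ae (ae_of_all _ fun z => ?_)
      simp only
      congr 3
      simp [WithLp.prod_inner_apply, PiLp.inner_apply]
    rw [h1, charFun_multivariateGaussian hD,
      charFun_multivariateGaussian (Matrix.PosDef.diagonal hlμ).posSemidef,
      charFun_multivariateGaussian (Matrix.PosDef.diagonal hlν).posSemidef, ← Complex.exp_add]
    congr 1
    simp [dotProduct, Matrix.mulVec_diagonal]
    ring
  rw [scaledGaussian, scaledGaussian, Measure.prod_smul_left, Measure.prod_smul_right, smul_smul,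
    ← ENNReal.ofReal_mul ha, splitMeasure, Measure.map_smul, hprod]

/-- The distortion is a signed sum of squares of second moments. -/
lemma distortion_splitMeasure {ρ : Measure (EuclideanSpace ℝ (Fin m ⊕ Fin n))} [IsFiniteMeasure ρ]
    (hρ : ∀ i j, Integrable (fun z => z i * z j) ρ) :
    distortion (splitMeasure ρ) ≠ ∞ ∧ (distortion (splitMeasure ρ)).toReal
      = ∑ i, ∑ j, secondMoment ρ (Sum.inl i) (Sum.inl j) ^ 2
        + ∑ i, ∑ j, secondMoment ρ (Sum.inr i) (Sum.inr j) ^ 2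
        - 2 * ∑ i, ∑ j, secondMoment ρ (Sum.inl i) (Sum.inr j) ^ 2 := by
  let s : Fin m ⊕ Fin n → ℝ := Sum.elim (fun _ => 1) (fun _ => -1)
  have hprod : (splitMeasure ρ).prod (splitMeasure ρ)
      = (ρ.prod ρ).map (Prod.map (splitEquiv m n) (splitEquiv m n)) :=
    Measure.map_prod_map _ _ (splitEquiv m n).measurable (splitEquiv m n).measurable
  have hpoint : ∀ z : EuclideanSpace ℝ (Fin m ⊕ Fin n) × EuclideanSpace ℝ (Fin m ⊕ Fin n),
      (inner ℝ (splitEquiv m n z.1).1 (splitEquiv m n z.2).1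
        - inner ℝ (splitEquiv m n z.1).2 (splitEquiv m n z.2).2) ^ 2
      = ∑ i, ∑ j, s i * s j * ((z.1 i * z.1 j) * (z.2 i * z.2 j)) := by
    intro z
    have h1 : inner ℝ (splitEquiv m n z.1).1 (splitEquiv m n z.2).1
        - inner ℝ (splitEquiv m n z.1).2 (splitEquiv m n z.2).2
        = ∑ i, s i * (z.1 i * z.2 i) := by
      simp [PiLp.inner_apply, s, mul_comm, sub_eq_add_neg]
    rw [h1, sq, Finset.sum_mul_sum]
    exact Finset.sum_congr rfl fun i _ => Finset.sum_congr rfl fun j _ => by ring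
  have hint1 : ∀ i j, Integrable (fun z : EuclideanSpace ℝ (Fin m ⊕ Fin n)
      × EuclideanSpace ℝ (Fin m ⊕ Fin n) => s i * s j * ((z.1 i * z.1 j) * (z.2 i * z.2 j)))
      (ρ.prod ρ) := fun i j => ((hρ i j).mul_prod (hρ i j)).const_mul _
  have hint2 := fun i => integrable_finsetSum Finset.univ fun j _ => hint1 i j
  have hint := integrable_finsetSum Finset.univ fun i _ => hint2 i
  have hL : distortion (splitMeasure ρ) = ∫⁻ z : EuclideanSpace ℝ (Fin m ⊕ Fin n)
      × EuclideanSpace ℝ (Fin m ⊕ Fin n),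
      ENNReal.ofReal (∑ i, ∑ j, s i * s j * ((z.1 i * z.1 j) * (z.2 i * z.2 j))) ∂(ρ.prod ρ) := by
    rw [distortion, hprod, lintegral_map (by fun_prop)
      ((splitEquiv m n).measurable.prodMap (splitEquiv m n).measurable)]
    refine lintegral_congr fun z => ?_
    rw [← hpoint]
    rfl
  have hnn : ∀ z : EuclideanSpace ℝ (Fin m ⊕ Fin n) × EuclideanSpace ℝ (Fin m ⊕ Fin n),
      0 ≤ ∑ i, ∑ j, s i * s j * ((z.1 i * z.1 j) * (z.2 i * z.2 j)) := fun z => by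
    rw [← hpoint]; positivity
  rw [hL, ← ofReal_integral_eq_lintegral_ofReal hint (ae_of_all _ hnn)]
  refine ⟨ENNReal.ofReal_ne_top, ?_⟩
  rw [ENNReal.toReal_ofReal (integral_nonneg hnn), integral_finsetSum _ fun i _ => hint2 i]
  have hterm : ∀ i, ∫ z : EuclideanSpace ℝ (Fin m ⊕ Fin n) × EuclideanSpace ℝ (Fin m ⊕ Fin n),
      ∑ j, s i * s j * ((z.1 i * z.1 j) * (z.2 i * z.2 j)) ∂(ρ.prod ρ)
      = ∑ j, s i * s j * secondMoment ρ i j ^ 2 := by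
    intro i
    rw [integral_finsetSum _ fun j _ => hint1 i j]
    refine Finset.sum_congr rfl fun j _ => ?_
    rw [integral_const_mul, integral_prod_mul
      (fun z : EuclideanSpace ℝ (Fin m ⊕ Fin n) => z i * z j)
      (fun z : EuclideanSpace ℝ (Fin m ⊕ Fin n) => z i * z j), sq]
    rfl
  simp_rw [hterm]
  have hsymm : ∑ i, ∑ j, secondMoment ρ (Sum.inr i) (Sum.inl j) ^ 2
      = ∑ i, ∑ j, secondMoment ρ (Sum.inl i) (Sum.inr j) ^ 2 := by
    rw [Finset.sum_comm]
    refine Finset.sum_congr rfl fun i _ => Finset.sum_congr rfl fun j _ => ?_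
    simp [secondMoment, mul_comm]
  simp only [Fintype.sum_sum_type, s, Sum.elim_inl, Sum.elim_inr, Finset.sum_add_distrib]
  simp only [mul_one, one_mul, mul_neg, neg_mul, neg_neg, Finset.sum_neg_distrib]
  rw [hsymm]
  ring

lemma covCost_eq (ε τ : ℝ) (lμ : Fin m → ℝ) (lν : Fin n → ℝ) (X : Matrix (Fin m) (Fin m) ℝ)
    (K : Matrix (Fin m) (Fin n) ℝ) (Y : Matrix (Fin n) (Fin n) ℝ) :
    covCost ε τ lμ lν X K Y
      = ∑ i, ∑ j, X i j ^ 2 + ∑ i, ∑ j, Y i j ^ 2 - 2 * ∑ i, ∑ j, K i j ^ 2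
        + τ * gaussKL lμ X + τ * gaussKL lν Y
        + ε * gaussKL (Sum.elim lμ lν) (Matrix.fromBlocks X K K.transpose Y) := by
  simp only [covCost, gaussKL, Fintype.sum_sum_type, Matrix.fromBlocks_apply₁₁,
    Matrix.fromBlocks_apply₂₂, Sum.elim_inl, Sum.elim_inr]
  ring

end Product

/-! ### The objective -/

section Objective

variable {m n : ℕ} {ε τ mμ mν : ℝ} {lμ : Fin m → ℝ} {lν : Fin n → ℝ}

/-- The value of the problem reduced to the squared mass `t`. -/
def massCost (ε τ mμ mν Υ t : ℝ) : ℝ :=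
  t * Υ + τ * (klScalar t (mμ ^ 2) + klScalar t (mν ^ 2)) + ε * klScalar t (mμ ^ 2 * mν ^ 2)

lemma klQuad_splitMeasure (hmμ : 0 < mμ)
    (hlμ : ∀ i, 0 < lμ i) (hlν : ∀ j, 0 < lν j)
    (ρ : Measure (EuclideanSpace ℝ (Fin m ⊕ Fin n))) [IsFiniteMeasure ρ] :
    klQuad (splitMeasure ρ) ((scaledGaussian mμ lμ).prod (scaledGaussian mν lν))
      = klQuad ρ (ENNReal.ofReal (mμ * mν)
        • multivariateGaussian 0 (Matrix.diagonal (Sum.elim lμ lν))) := by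
  rw [prod_scaledGaussian hmμ.le hlμ hlν, splitMeasure, splitMeasure, klQuad_map_equiv]

lemma objective_splitMeasure (hmμ : 0 < mμ)
    (hlμ : ∀ i, 0 < lμ i) (hlν : ∀ j, 0 < lν j)
    (ρ : Measure (EuclideanSpace ℝ (Fin m ⊕ Fin n))) [IsFiniteMeasure ρ] :
    objective ε τ (scaledGaussian mμ lμ) (scaledGaussian mν lν) (splitMeasure ρ)
      = distortion (splitMeasure ρ)
        + ENNReal.ofReal τ * klQuad (leftMarginal ρ)
            (ENNReal.ofReal mμ • multivariateGaussian 0 (Matrix.diagonal lμ))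
        + ENNReal.ofReal τ * klQuad (rightMarginal ρ)
            (ENNReal.ofReal mν • multivariateGaussian 0 (Matrix.diagonal lν))
        + ENNReal.ofReal ε * klQuad ρ (ENNReal.ofReal (mμ * mν)
            • multivariateGaussian 0 (Matrix.diagonal (Sum.elim lμ lν))) := by
  rw [objective, klQuad_splitMeasure hmμ hlμ hlν, fst_splitMeasure, snd_splitMeasure]
  rfl

lemma toReal_objective {D A B C : ℝ≥0∞} {ε τ : ℝ} (hε : 0 < ε) (hτ : 0 < τ) (hD : D ≠ ∞)
    (hA : A ≠ ∞) (hB : B ≠ ∞) (hC : C ≠ ∞) :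
    D + ENNReal.ofReal τ * A + ENNReal.ofReal τ * B + ENNReal.ofReal ε * C ≠ ∞ ∧
    (D + ENNReal.ofReal τ * A + ENNReal.ofReal τ * B + ENNReal.ofReal ε * C).toReal
      = D.toReal + τ * A.toReal + τ * B.toReal + ε * C.toReal := by
  have hA' := ENNReal.mul_ne_top (ENNReal.ofReal_ne_top (r := τ)) hA
  have hB' := ENNReal.mul_ne_top (ENNReal.ofReal_ne_top (r := τ)) hB
  have hC' := ENNReal.mul_ne_top (ENNReal.ofReal_ne_top (r := ε)) hC
  refine ⟨by simp [hD, hA', hB', hC'], ?_⟩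
  rw [ENNReal.toReal_add (by simp [hD, hA', hB']) hC', ENNReal.toReal_add (by simp [hD, hA']) hB',
    ENNReal.toReal_add hD hA', ENNReal.toReal_mul, ENNReal.toReal_mul, ENNReal.toReal_mul,
    ENNReal.toReal_ofReal hτ.le, ENNReal.toReal_ofReal hε.le]

/-- The objective at a scaled Gaussian measure. -/
lemma objective_gaussian (hε : 0 < ε) (hτ : 0 < τ) (hmμ : 0 < mμ) (hmν : 0 < mν)
    (hlμ : ∀ i, 0 < lμ i) (hlν : ∀ j, 0 < lν j) {M : ℝ} (hM : 0 < M)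
    {X : Matrix (Fin m) (Fin m) ℝ} {K : Matrix (Fin m) (Fin n) ℝ} {Y : Matrix (Fin n) (Fin n) ℝ}
    (hT : (Matrix.fromBlocks X K K.transpose Y).PosDef) :
    objective ε τ (scaledGaussian mμ lμ) (scaledGaussian mν lν)
        (scaledGaussianProd M (Matrix.fromBlocks X K K.transpose Y)) ≠ ∞ ∧
      (objective ε τ (scaledGaussian mμ lμ) (scaledGaussian mν lν)
        (scaledGaussianProd M (Matrix.fromBlocks X K K.transpose Y))).toReal
        = massCost ε τ mμ mν (covCost ε τ lμ lν X K Y) (M ^ 2) := by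
  set T := Matrix.fromBlocks X K K.transpose Y with hTdef
  have hX : X.PosDef := hT.submatrix Sum.inl_injective
  have hY : Y.PosDef := hT.submatrix Sum.inr_injective
  have hl : ∀ k, 0 < Sum.elim lμ lν k := by
    rintro (i | j)
    · exact hlμ i
    · exact hlν j
  rw [scaledGaussianProd_eq, objective_splitMeasure hmμ hlμ hlν,
    leftMarginal_gaussian M hT.posSemidef, rightMarginal_gaussian M hT.posSemidef]
  have hXb : T.toBlocks₁₁ = X := Matrix.toBlocks_fromBlocks₁₁ _ _ _ _
  have hYb : T.toBlocks₂₂ = Y := Matrix.toBlocks_fromBlocks₂₂ _ _ _ _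
  rw [hXb, hYb]
  obtain ⟨a1, a2⟩ := klQuad_gaussian hmμ hM hlμ hX
  obtain ⟨b1, b2⟩ := klQuad_gaussian hmν hM hlν hY
  obtain ⟨c1, c2⟩ := klQuad_gaussian (mul_pos hmμ hmν) hM hl hT
  obtain ⟨d1, d2⟩ := distortion_splitMeasure
    (ρ := ENNReal.ofReal M • multivariateGaussian 0 T)
    (fun i j => (integrable_coord_mul_gaussian T i j).smul_measure ENNReal.ofReal_ne_top)
  obtain ⟨e1, e2⟩ := toReal_objective hε hτ d1 a1 b1 c1
  refine ⟨e1, ?_⟩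
  rw [e2, a2, b2, c2, d2, secondMoment_smul_gaussian hM.le hT.posSemidef, massCost, covCost_eq,
    mul_pow mμ mν]
  simp only [hTdef, Matrix.smul_apply, smul_eq_mul, Matrix.fromBlocks_apply₁₁,
    Matrix.fromBlocks_apply₁₂, Matrix.fromBlocks_apply₂₂, mul_pow, ← Finset.mul_sum]
  ring

lemma klQuad_zero_left {X : Type*} [MeasurableSpace X] (β : Measure X) [IsFiniteMeasure β] :
    (klQuad 0 β).toReal = β.real Set.univ ^ 2 := by
  rw [klQuad, Measure.zero_prod, klDiv_zero_left, ← measureReal_def, real_prod_univ]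

/-- The lower bound for the objective at an arbitrary measure `ρ` of mass `p`. The regularized
second-moment matrix `T = p⁻¹ ∫ z zᵀ dρ + δ I` is positive definite, and `δ → 0` at the end. -/
lemma massCost_le_objective (hε : 0 < ε) (hτ : 0 < τ) (hmμ : 0 < mμ) (hmν : 0 < mν)
    (hlμ : ∀ i, 0 < lμ i) (hlν : ∀ j, 0 < lν j) {Υ : ℝ}
    (hΥ : ∀ (X : Matrix (Fin m) (Fin m) ℝ) (K : Matrix (Fin m) (Fin n) ℝ)
      (Y : Matrix (Fin n) (Fin n) ℝ), X.PosDef → Y.PosDef →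
      (Matrix.fromBlocks X K K.transpose Y).PosDef → Υ ≤ covCost ε τ lμ lν X K Y)
    (ρ : Measure (EuclideanSpace ℝ (Fin m ⊕ Fin n))) [IsFiniteMeasure ρ]
    (hfin : objective ε τ (scaledGaussian mμ lμ) (scaledGaussian mν lν) (splitMeasure ρ) ≠ ∞) :
    massCost ε τ mμ mν Υ (ρ.real Set.univ ^ 2)
      ≤ (objective ε τ (scaledGaussian mμ lμ) (scaledGaussian mν lν) (splitMeasure ρ)).toReal := by
  have hl : ∀ k, 0 < Sum.elim lμ lν k := by
    rintro (i | j)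
    · exact hlμ i
    · exact hlν j
  rw [objective_splitMeasure hmμ hlμ hlν] at hfin ⊢
  have hτ' : ENNReal.ofReal τ ≠ 0 := (ENNReal.ofReal_pos.2 hτ).ne'
  have hε' : ENNReal.ofReal ε ≠ 0 := (ENNReal.ofReal_pos.2 hε).ne'
  have hD : distortion (splitMeasure ρ) ≠ ∞ := fun h => hfin (by simp [h])
  have hA : klQuad (leftMarginal ρ)
      (ENNReal.ofReal mμ • multivariateGaussian 0 (Matrix.diagonal lμ)) ≠ ∞ :=
    fun h => hfin (by simp [h, ENNReal.mul_top hτ'])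
  have hB : klQuad (rightMarginal ρ)
      (ENNReal.ofReal mν • multivariateGaussian 0 (Matrix.diagonal lν)) ≠ ∞ :=
    fun h => hfin (by simp [h, ENNReal.mul_top hτ'])
  have hC : klQuad ρ (ENNReal.ofReal (mμ * mν)
      • multivariateGaussian 0 (Matrix.diagonal (Sum.elim lμ lν))) ≠ ∞ :=
    fun h => hfin (by simp [h, ENNReal.mul_top hε'])
  rw [(toReal_objective hε hτ hD hA hB hC).2]
  rcases eq_zero_or_neZero ρ with rfl | hρ
  · have h1 : leftMarginal (0 : Measure (EuclideanSpace ℝ (Fin m ⊕ Fin n))) = 0 := by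
      simp [leftMarginal]
    have h2 : rightMarginal (0 : Measure (EuclideanSpace ℝ (Fin m ⊕ Fin n))) = 0 := by
      simp [rightMarginal]
    rw [h1, h2, klQuad_zero_left, klQuad_zero_left, klQuad_zero_left,
      real_univ_smul_gaussian hmμ.le, real_univ_smul_gaussian hmν.le,
      real_univ_smul_gaussian (mul_pos hmμ hmν).le]
    have h3 : 0 ≤ (distortion (splitMeasure (0 : Measure (EuclideanSpace ℝ (Fin m ⊕ Fin n))))).toReal :=
      ENNReal.toReal_nonneg
    simp only [massCost, klScalar, measureReal_zero, Pi.zero_apply]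
    rw [mul_pow mμ mν]
    simp only [ne_eq, OfNat.ofNat_ne_zero, not_false_eq_true, zero_pow, zero_mul,
      sub_zero, zero_add]
    linarith
  have hp : 0 < ρ.real Set.univ := measureReal_univ_pos
  set p := ρ.real Set.univ with hpdef
  have hmom := integrable_coord_mul_of_klQuad hC
  obtain ⟨-, hDval⟩ := distortion_splitMeasure hmom
  set A := secondMoment ρ with hAdef
  have hApsd : A.PosSemidef := posSemidef_secondMoment hmom
  have hAsymm : ∀ i j, A i j = A j i := fun i j => by
    have := hApsd.isHermitian.apply i j
    rwa [star_trivial, eq_comm] at this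
  -- the error terms of the regularization, to first and second order in `δ`
  set c₁ : ℝ := 2 * (p⁻¹ * ∑ i, A (Sum.inl i) (Sum.inl i) + p⁻¹ * ∑ j, A (Sum.inr j) (Sum.inr j))
    + τ * ∑ i, (lμ i)⁻¹ + τ * ∑ j, (lν j)⁻¹ + ε * ∑ k, (Sum.elim lμ lν k)⁻¹ with hc₁
  set c₂ : ℝ := (m : ℝ) + n with hc₂
  have key : ∀ δ : ℝ, 0 < δ → massCost ε τ mμ mν Υ (p ^ 2) - p ^ 2 * (c₁ * δ + c₂ * δ ^ 2)
      ≤ (distortion (splitMeasure ρ)).toReal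
        + τ * (klQuad (leftMarginal ρ)
          (ENNReal.ofReal mμ • multivariateGaussian 0 (Matrix.diagonal lμ))).toReal
        + τ * (klQuad (rightMarginal ρ)
          (ENNReal.ofReal mν • multivariateGaussian 0 (Matrix.diagonal lν))).toReal
        + ε * (klQuad ρ (ENNReal.ofReal (mμ * mν)
          • multivariateGaussian 0 (Matrix.diagonal (Sum.elim lμ lν)))).toReal := by
    intro δ hδ
    have hTpd : (p⁻¹ • A + δ • (1 : Matrix (Fin m ⊕ Fin n) (Fin m ⊕ Fin n) ℝ)).PosDef :=
      (Matrix.PosDef.one.smul hδ).posSemidef_add (hApsd.smul (inv_nonneg.2 hp.le))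
    set X := p⁻¹ • A.toBlocks₁₁ + δ • (1 : Matrix (Fin m) (Fin m) ℝ) with hX
    set K := p⁻¹ • A.toBlocks₁₂ with hK
    set Y := p⁻¹ • A.toBlocks₂₂ + δ • (1 : Matrix (Fin n) (Fin n) ℝ) with hY
    have hT : p⁻¹ • A + δ • (1 : Matrix (Fin m ⊕ Fin n) (Fin m ⊕ Fin n) ℝ)
        = Matrix.fromBlocks X K K.transpose Y := by
      ext i j
      rcases i with i | i <;> rcases j with j | j <;>
        simp [hX, hK, hY, Matrix.toBlocks₁₁, Matrix.toBlocks₁₂, Matrix.toBlocks₂₂,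
          Matrix.one_apply, hAsymm (Sum.inr _) (Sum.inl _)]
    have g1 := gaussKL_le_klQuad hmμ hp (real_univ_leftMarginal ρ) hδ hlμ hA
    have g2 := gaussKL_le_klQuad hmν hp (real_univ_rightMarginal ρ) hδ hlν hB
    have g3 := gaussKL_le_klQuad (mul_pos hmμ hmν) hp hpdef.symm hδ hl hC
    rw [secondMoment_leftMarginal, ← hAdef, ← hX] at g1
    rw [secondMoment_rightMarginal, ← hAdef, ← hY] at g2
    rw [← hAdef, hT, mul_pow mμ mν] at g3
    rw [hT] at hTpd
    have hcost := hΥ X K Y (hTpd.submatrix Sum.inl_injective) (hTpd.submatrix Sum.inr_injective)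
      hTpd
    rw [covCost_eq] at hcost
    have hsq : ∀ {d : ℕ} (B : Matrix (Fin d) (Fin d) ℝ),
        ∑ i, ∑ j, (p⁻¹ • B + δ • (1 : Matrix (Fin d) (Fin d) ℝ)) i j ^ 2
        = p⁻¹ ^ 2 * ∑ i, ∑ j, B i j ^ 2 + 2 * δ * (p⁻¹ * ∑ i, B i i) + d * δ ^ 2 := by
      intro d B
      have h1 : ∀ i j, (p⁻¹ • B + δ • (1 : Matrix (Fin d) (Fin d) ℝ)) i j ^ 2
          = p⁻¹ ^ 2 * B i j ^ 2 + if i = j then 2 * δ * p⁻¹ * B i j + δ ^ 2 else 0 := by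
        intro i j
        simp only [Matrix.add_apply, Matrix.smul_apply, smul_eq_mul, Matrix.one_apply]
        split_ifs <;> ring
      simp_rw [h1, Finset.sum_add_distrib, ← Finset.mul_sum]
      simp only [Finset.sum_ite_eq, Finset.mem_univ, if_true, Finset.sum_add_distrib,
        ← Finset.mul_sum]
      simp
      ring
    have hKsq : ∑ i, ∑ j, K i j ^ 2 = p⁻¹ ^ 2 * ∑ i, ∑ j, A.toBlocks₁₂ i j ^ 2 := by
      simp only [hK, Matrix.smul_apply, smul_eq_mul, mul_pow, ← Finset.mul_sum]
    rw [hKsq, hX, hY, hsq, hsq, ← hX, ← hY] at hcost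
    have hDval' : (distortion (splitMeasure ρ)).toReal
        = p ^ 2 * (p⁻¹ ^ 2 * ∑ i, ∑ j, A.toBlocks₁₁ i j ^ 2
          + p⁻¹ ^ 2 * ∑ i, ∑ j, A.toBlocks₂₂ i j ^ 2
          - 2 * (p⁻¹ ^ 2 * ∑ i, ∑ j, A.toBlocks₁₂ i j ^ 2)) := by
      rw [hDval]
      have h1 : p ^ 2 * p⁻¹ ^ 2 = 1 := by
        rw [← mul_pow, mul_inv_cancel₀ hp.ne', one_pow]
      simp only [Matrix.toBlocks₁₁, Matrix.toBlocks₁₂, Matrix.toBlocks₂₂, Matrix.of_apply]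
      linear_combination (-(∑ i, ∑ j, A (Sum.inl i) (Sum.inl j) ^ 2
        + ∑ i, ∑ j, A (Sum.inr i) (Sum.inr j) ^ 2
        - 2 * ∑ i, ∑ j, A (Sum.inl i) (Sum.inr j) ^ 2)) * h1
    have hcost' := mul_le_mul_of_nonneg_left hcost (sq_nonneg p)
    have g1' := mul_le_mul_of_nonneg_left g1 hτ.le
    have g2' := mul_le_mul_of_nonneg_left g2 hτ.le
    have g3' := mul_le_mul_of_nonneg_left g3 hε.le
    have e1 : ∑ i, A.toBlocks₁₁ i i = ∑ i, A (Sum.inl i) (Sum.inl i) := rfl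
    have e2 : ∑ i, A.toBlocks₂₂ i i = ∑ i, A (Sum.inr i) (Sum.inr i) := rfl
    rw [e1, e2] at hcost'
    rw [hDval', massCost, hc₁, hc₂]
    linarith
  have hlim : Filter.Tendsto
      (fun δ : ℝ => massCost ε τ mμ mν Υ (p ^ 2) - p ^ 2 * (c₁ * δ + c₂ * δ ^ 2))
      (nhdsWithin 0 (Set.Ioi 0)) (nhds (massCost ε τ mμ mν Υ (p ^ 2))) := by
    have hcont : Continuous
        (fun δ : ℝ => massCost ε τ mμ mν Υ (p ^ 2) - p ^ 2 * (c₁ * δ + c₂ * δ ^ 2)) := by fun_prop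
    have h := hcont.tendsto 0
    simp only [mul_zero, ne_eq, OfNat.ofNat_ne_zero, not_false_eq_true, zero_pow, add_zero,
      sub_zero] at h
    exact h.mono_left nhdsWithin_le_nhds
  refine le_of_tendsto hlim ?_
  filter_upwards [self_mem_nhdsWithin] with δ hδ
  exact key δ hδ

end Objective

/-! ### The optimal Gaussian plan -/

section OptimalPlan

variable {m n : ℕ} {ε τ : ℝ} {lμ : Fin m → ℝ} {lν : Fin n → ℝ}

lemma rectDiag_mul_diagonal_mul_transpose (ψ y : Fin n → ℝ) :
    rectDiag (m := m) ψ * Matrix.diagonal y * (rectDiag (m := m) ψ).transpose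
      = Matrix.diagonal fun i : Fin m => if h : (i : ℕ) < n then ψ ⟨i, h⟩ ^ 2 * y ⟨i, h⟩ else 0 := by
  ext i j
  rw [Matrix.mul_apply]
  have h1 : ∀ k : Fin n, (rectDiag (m := m) ψ * Matrix.diagonal y) i k
      * (rectDiag (m := m) ψ).transpose k j
      = if (i : ℕ) = k ∧ (j : ℕ) = k then ψ k ^ 2 * y k else 0 := by
    intro k
    rw [Matrix.mul_diagonal, Matrix.transpose_apply, rectDiag, rectDiag]
    split_ifs with h1 h2 h3 h4 h5 <;> first | omega | ring1
  simp_rw [h1]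
  by_cases hij : i = j
  · subst hij
    rw [Matrix.diagonal_apply_eq]
    split_ifs with h
    · rw [Finset.sum_eq_single ⟨i, h⟩]
      · simp
      · intro k _ hk
        rw [if_neg]
        rintro ⟨h2, -⟩
        exact hk (Fin.ext h2.symm)
      · simp
    · refine Finset.sum_eq_zero fun k _ => if_neg ?_
      rintro ⟨h2, -⟩
      omega
  · rw [Matrix.diagonal_apply_ne _ hij]
    refine Finset.sum_eq_zero fun k _ => if_neg ?_
    rintro ⟨h2, h3⟩
    exact hij (Fin.ext (h2.trans h3.symm))

lemma sum_rectDiag_sq (hnm : n ≤ m) (ψ : Fin n → ℝ) :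
    ∑ i, ∑ j, rectDiag (m := m) ψ i j ^ 2 = ∑ k, ψ k ^ 2 := by
  rw [Finset.sum_comm]
  refine Finset.sum_congr rfl fun k _ => ?_
  rw [Finset.sum_eq_single (Fin.castLE hnm k)]
  · simp [rectDiag]
  · intro i _ hi
    rw [rectDiag, if_neg]
    · simp
    · intro h
      exact hi (Fin.ext h)
  · simp

/-- Positivity and determinant of the block covariance matrix, by the Schur complement
`x_k - ψ_k² / y_k`. -/
lemma posDef_blockCov (hnm : n ≤ m) {x : Fin m → ℝ} {y ψ : Fin n → ℝ}
    (hx : ∀ i, 0 < x i) (hy : ∀ j, 0 < y j)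
    (hψ : ∀ k, ψ k ^ 2 < x (Fin.castLE hnm k) * y k) :
    (blockCov x y ψ).PosDef ∧ Real.log (blockCov x y ψ).det
      = ∑ i, Real.log (x i) + ∑ j, Real.log (y j)
        + ∑ k, (Real.log (x (Fin.castLE hnm k) * y k - ψ k ^ 2)
          - Real.log (x (Fin.castLE hnm k) * y k)) := by
  set d : Fin m → ℝ := fun i => x i - if h : (i : ℕ) < n then ψ ⟨i, h⟩ ^ 2 * (y ⟨i, h⟩)⁻¹ else 0
    with hd
  have hdk : ∀ k : Fin n, d (Fin.castLE hnm k)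
      = (x (Fin.castLE hnm k) * y k - ψ k ^ 2) / y k := by
    intro k
    have h1 : ((Fin.castLE hnm k : Fin m) : ℕ) < n := k.isLt
    simp only [hd, dif_pos h1]
    have := (hy k).ne'
    change x (Fin.castLE hnm k) - ψ k ^ 2 * (y k)⁻¹ = _
    field_simp
  have hdn : ∀ i : Fin m, n ≤ (i : ℕ) → d i = x i := fun i hi => by
    simp [hd, not_lt.2 hi]
  have hd0 : ∀ i, 0 < d i := by
    intro i
    rcases lt_or_ge (i : ℕ) n with h | h
    · have h1 : i = Fin.castLE hnm ⟨i, h⟩ := rfl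
      rw [h1, hdk]
      exact div_pos (sub_pos.2 (hψ _)) (hy _)
    · rw [hdn i h]; exact hx i
  have hyPD : (Matrix.diagonal y).PosDef := Matrix.PosDef.diagonal hy
  have hyinv : (Matrix.diagonal y)⁻¹ = Matrix.diagonal fun j => (y j)⁻¹ := by
    refine Matrix.inv_eq_left_inv ?_
    rw [Matrix.diagonal_mul_diagonal, ← Matrix.diagonal_one]
    congr 1; funext i; exact inv_mul_cancel₀ (hy i).ne'
  have hschur : Matrix.diagonal x - rectDiag ψ * (Matrix.diagonal y)⁻¹ * (rectDiag ψ).transpose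
      = Matrix.diagonal d := by
    rw [hyinv, rectDiag_mul_diagonal_mul_transpose, Matrix.diagonal_sub]
  have : Invertible (Matrix.diagonal y) := hyPD.isUnit.invertible
  have hdet : (blockCov x y ψ).det = (∏ j, y j) * ∏ i, d i := by
    rw [blockCov, Matrix.det_fromBlocks₂₂, Matrix.invOf_eq_nonsing_inv, hschur,
      Matrix.det_diagonal, Matrix.det_diagonal]
  have hdetpos : 0 < (blockCov x y ψ).det := by
    rw [hdet]
    exact mul_pos (Finset.prod_pos fun j _ => hy j) (Finset.prod_pos fun i _ => hd0 i)
  constructor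
  · have hpsd : (blockCov x y ψ).PosSemidef := by
      rw [blockCov, ← Matrix.conjTranspose_eq_transpose_of_trivial,
        hyPD.fromBlocks₂₂, Matrix.conjTranspose_eq_transpose_of_trivial,
        hschur]
      exact (Matrix.PosDef.diagonal hd0).posSemidef
    exact hpsd.posDef_iff_det_ne_zero.2 hdetpos.ne'
  · rw [hdet, Real.log_mul (Finset.prod_pos fun j _ => hy j).ne'
      (Finset.prod_pos fun i _ => hd0 i).ne', Real.log_prod fun j _ => (hy j).ne',
      Real.log_prod fun i _ => (hd0 i).ne', ← sum_castLE_add_sum_filter hnm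
        (fun i => Real.log (d i)), ← sum_castLE_add_sum_filter hnm (fun i => Real.log (x i))]
    have h1 : ∑ k ∈ Finset.univ.filter (fun k : Fin m => n ≤ (k : ℕ)), Real.log (d k)
        = ∑ k ∈ Finset.univ.filter (fun k : Fin m => n ≤ (k : ℕ)), Real.log (x k) :=
      Finset.sum_congr rfl fun k hk => by rw [hdn k (Finset.mem_filter.1 hk).2]
    have h2 : ∀ k : Fin n, Real.log (d (Fin.castLE hnm k))
        = Real.log (x (Fin.castLE hnm k) * y k - ψ k ^ 2) - Real.log (y k) := by
      intro k
      rw [hdk, Real.log_div (sub_pos.2 (hψ k)).ne' (hy k).ne']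
    have h3 : ∀ k : Fin n, Real.log (x (Fin.castLE hnm k) * y k)
        = Real.log (x (Fin.castLE hnm k)) + Real.log (y k) := fun k =>
      Real.log_mul (hx _).ne' (hy k).ne'
    rw [h1]
    simp_rw [h2, h3, Finset.sum_sub_distrib, Finset.sum_add_distrib]
    ring

lemma sq_crossCov {t : ℝ} (ht : 0 < t) :
    Real.sqrt (max (1 - ε / (2 * t)) 0 * t) ^ 2 = max (t - ε / 2) 0 := by
  rw [Real.sq_sqrt (mul_nonneg (le_max_right _ _) ht.le), max_mul_of_nonneg _ _ ht.le, zero_mul]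
  congr 1
  field_simp

/-- With the optimal cross-covariance, the block matrix attains the scalar value. -/
lemma covCost_blockCov (hnm : n ≤ m) (hε : 0 < ε)
    (hlμ : ∀ i, 0 < lμ i) (hlν : ∀ j, 0 < lν j) {x : Fin m → ℝ} {y ψ : Fin n → ℝ}
    (hx : ∀ i, 0 < x i) (hy : ∀ j, 0 < y j)
    (hψ : ∀ k, ψ k ^ 2 = max (x (Fin.castLE hnm k) * y k - ε / 2) 0) :
    (blockCov x y ψ).PosDef ∧
      covCost ε τ lμ lν (Matrix.diagonal x) (rectDiag ψ) (Matrix.diagonal y)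
        = upsilon hnm ε τ lμ lν x y := by
  have hxy : ∀ k : Fin n, 0 < x (Fin.castLE hnm k) * y k := fun k => mul_pos (hx _) (hy k)
  obtain ⟨h1, h2⟩ := posDef_blockCov hnm hx hy (ψ := ψ) fun k => by
    rw [hψ]; exact max_lt (by linarith) (hxy k)
  refine ⟨h1, ?_⟩
  rw [blockCov] at h2
  rw [upsilon_eq hnm hlμ hlν hx hy, covCost, h2, log_det_diagonal hx, log_det_diagonal hy,
    sum_rectDiag_sq hnm]
  simp_rw [crossTerm_eq hε (hxy _), ← hψ]
  have hsq : ∀ {d : ℕ} (v : Fin d → ℝ), ∑ i, ∑ j, Matrix.diagonal v i j ^ 2 = ∑ i, v i ^ 2 := by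
    intro d v
    exact Finset.sum_congr rfl fun i _ => by simp [Matrix.diagonal_apply]
  rw [hsq, hsq]
  simp only [Matrix.diagonal_apply_eq, Finset.sum_add_distrib, Finset.sum_sub_distrib,
    ← Finset.mul_sum]
  ring

lemma upsilon_le_of_argmin (hnm : n ≤ m) {φ x : Fin m → ℝ} {ϕ y : Fin n → ℝ}
    (hG : ∀ k : Fin n, argminG ε τ (lμ (Fin.castLE hnm k)) (lν k)
      = {(φ (Fin.castLE hnm k), ϕ k)})
    (hH : ∀ k : Fin m, n ≤ (k : ℕ) → argminH ε τ (lμ k) = {φ k})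
    (hx : ∀ i, 0 < x i) (hy : ∀ j, 0 < y j) :
    upsilon hnm ε τ lμ lν φ ϕ ≤ upsilon hnm ε τ lμ lν x y := by
  refine add_le_add (Finset.sum_le_sum fun k _ => ?_) (Finset.sum_le_sum fun k hk => ?_)
  · have h : (φ (Fin.castLE hnm k), ϕ k) ∈ argminG ε τ (lμ (Fin.castLE hnm k)) (lν k) := by
      rw [hG k]; rfl
    exact h.2.2 _ _ (hx _) (hy k)
  · have h : φ k ∈ argminH ε τ (lμ k) := by
      rw [hH k (Finset.mem_filter.1 hk).2]; rfl
    exact h.2 _ (hx k)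

end OptimalPlan

end EntropicUIGW

end

open EntropicUIGW in
theorem theorem2 {m n : ℕ} (hnm : n ≤ m) (ε τ mμ mν : ℝ)
    (hε : 0 < ε) (hτ : 0 < τ) (hmμ : 0 < mμ) (hmν : 0 < mν)
    (lμ : Fin m → ℝ) (lν : Fin n → ℝ)
    (hlμ : ∀ i, 0 < lμ i) (hlν : ∀ j, 0 < lν j)
    (hlμ_anti : Antitone lμ) (hlν_anti : Antitone lν) :
    ∃ (φ : Fin m → ℝ) (ϕ : Fin n → ℝ),
      -- the coordinatewise minimizers exist and are unique
      (∀ k : Fin n, argminG ε τ (lμ (Fin.castLE hnm k)) (lν k) = {(φ (Fin.castLE hnm k), ϕ k)}) ∧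
      (∀ k : Fin m, n ≤ (k : ℕ) → argminH ε τ (lμ k) = {φ k}) ∧
      -- they are given by a quadratic equation or by a cubic equation
      (∀ k : Fin n,
        quadSol ε τ (lμ (Fin.castLE hnm k)) * quadSol ε τ (lν k) < ε / 2 →
          φ (Fin.castLE hnm k) = quadSol ε τ (lμ (Fin.castLE hnm k)) ∧
          ϕ k = quadSol ε τ (lν k)) ∧
      (∀ k : Fin n,
        ε / 2 ≤ quadSol ε τ (lμ (Fin.castLE hnm k)) * quadSol ε τ (lν k) →
          ∃ z : ℝ, {w : ℝ | 0 < w ∧ cubic ε τ (lμ (Fin.castLE hnm k)) (lν k) w = 0} = {z} ∧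
            φ (Fin.castLE hnm k) = cubicSol ε τ (lμ (Fin.castLE hnm k)) z ∧
            ϕ k = cubicSol ε τ (lν k) z) ∧
      (∀ k : Fin m, n ≤ (k : ℕ) → φ k = quadSol ε τ (lμ k)) ∧
      -- value of the problem and an optimal plan
      ∃ (Υ M : ℝ) (ψ : Fin n → ℝ),
        Υ = upsilon hnm ε τ lμ lν φ ϕ ∧
        0 < M ∧ M ^ 2 = massSq ε τ mμ mν Υ ∧
        (∀ k : Fin n, ψ k =
          Real.sqrt (max (1 - ε / (2 * (φ (Fin.castLE hnm k) * ϕ k))) 0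
            * (φ (Fin.castLE hnm k) * ϕ k))) ∧
        UIGW ε τ (scaledGaussian mμ lμ) (scaledGaussian mν lν) ≠ ∞ ∧
        (UIGW ε τ (scaledGaussian mμ lμ) (scaledGaussian mν lν)).toReal =
          M ^ 2 * Υ + τ * (klScalar (M ^ 2) (mμ ^ 2) + klScalar (M ^ 2) (mν ^ 2))
            + ε * klScalar (M ^ 2) (mμ ^ 2 * mν ^ 2) ∧
        (blockCov φ ϕ ψ).PosDef ∧
        IsOptimalPlan ε τ (scaledGaussian mμ lμ) (scaledGaussian mν lν)
          (scaledGaussianProd M (blockCov φ ϕ ψ)) := by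
  choose X Y hX hY hG hq hc using fun k : Fin n =>
    exists_argminG (a := lμ (Fin.castLE hnm k)) (b := lν k) hε hτ (hlμ _) (hlν _)
  -- the coordinates beyond `n` are uncoupled
  let φ : Fin m → ℝ := fun k => if h : (k : ℕ) < n then X ⟨k, h⟩ else quadSol ε τ (lμ k)
  have hφ : ∀ k : Fin n, φ (Fin.castLE hnm k) = X k := fun k => by simp [φ]
  have hφ' : ∀ k : Fin m, n ≤ (k : ℕ) → φ k = quadSol ε τ (lμ k) := fun k hk => by
    simp [φ, not_lt.2 hk]
  have hφ0 : ∀ i, 0 < φ i := by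
    intro i
    simp only [φ]
    split_ifs
    · exact hX _
    · exact quadSol_pos hε hτ (hlμ i)
  have hG' : ∀ k : Fin n, argminG ε τ (lμ (Fin.castLE hnm k)) (lν k)
      = {(φ (Fin.castLE hnm k), Y k)} := fun k => by rw [hφ, hG]
  have hH' : ∀ k : Fin m, n ≤ (k : ℕ) → argminH ε τ (lμ k) = {φ k} := fun k hk => by
    rw [hφ' k hk, argminH_eq hε hτ (hlμ k)]
  refine ⟨φ, Y, hG', hH', fun k hk => ?_, fun k hk => ?_, hφ', ?_⟩
  · rw [hφ]; exact hq k hk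
  · rw [hφ]; exact hc k hk
  set Υ := upsilon hnm ε τ lμ lν φ Y with hΥ
  have hs : 0 < massSq ε τ mμ mν Υ := by rw [massSq]; positivity
  set M := Real.sqrt (massSq ε τ mμ mν Υ) with hMdef
  have hM : 0 < M := Real.sqrt_pos.2 hs
  have hMsq : M ^ 2 = massSq ε τ mμ mν Υ := Real.sq_sqrt hs.le
  set ψ : Fin n → ℝ := fun k => Real.sqrt (max (1 - ε / (2 * (φ (Fin.castLE hnm k) * Y k))) 0
    * (φ (Fin.castLE hnm k) * Y k)) with hψ
  obtain ⟨hpd, hcost⟩ := covCost_blockCov (τ := τ) hnm hε hlμ hlν hφ0 hY (ψ := ψ)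
    fun k => sq_crossCov (mul_pos (hφ0 _) (hY k))
  obtain ⟨hfin, hval⟩ := objective_gaussian hε hτ hmμ hmν hlμ hlν hM hpd
  rw [← blockCov] at hfin hval
  rw [hcost, ← hΥ] at hval
  have hopt : IsOptimalPlan ε τ (scaledGaussian mμ lμ) (scaledGaussian mν lν)
      (scaledGaussianProd M (blockCov φ Y ψ)) := by
    refine ⟨by rw [scaledGaussianProd_eq]; infer_instance, fun π' hπ' => ?_⟩
    obtain ⟨ρ, hρ, rfl⟩ : ∃ ρ : Measure (EuclideanSpace ℝ (Fin m ⊕ Fin n)),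
        IsFiniteMeasure ρ ∧ π' = splitMeasure ρ :=
      ⟨π'.map (splitEquiv m n).symm, inferInstance, by
        rw [splitMeasure, MeasurableEquiv.map_map_symm]⟩
    by_cases htop : objective ε τ (scaledGaussian mμ lμ) (scaledGaussian mν lν)
        (splitMeasure ρ) = ∞
    · rw [htop]; exact le_top
    · rw [← ENNReal.toReal_le_toReal hfin htop]
      refine le_trans (le_of_eq hval) (le_trans ?_
        (massCost_le_objective hε hτ hmμ hmν hlμ hlν (Υ := Υ) (fun A K B hA hB hT => ?_) ρ htop))
      · rw [hMsq]
        exact massSq_minimizes hε hτ hmμ hmν (sq_nonneg _)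
      · obtain ⟨x, y, hx, hy, hxy⟩ :=
          exists_upsilon_le_covCost hnm hε hτ hlμ hlν hlμ_anti hlν_anti hA hB hT
        exact (upsilon_le_of_argmin hnm hG' hH' hx hy).trans hxy
  have hU : UIGW ε τ (scaledGaussian mμ lμ) (scaledGaussian mν lν)
      = objective ε τ (scaledGaussian mμ lμ) (scaledGaussian mν lν)
        (scaledGaussianProd M (blockCov φ Y ψ)) :=
    le_antisymm (iInf₂_le _ hopt.1) (le_iInf₂ hopt.2)
  refine ⟨Υ, M, ψ, rfl, hM, hMsq, fun k => rfl, ?_, ?_, hpd, hopt⟩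
  · rw [hU]; exact hfin
  · rw [hU]; exact hval
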